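/- For positive integers $b,c$ let $x_n=x_n^{(b,c)}(x_1,x_2)\in\mathbb{Q}(x_1,x_2)$, $n\in\mathbb{Z}$, be the sequence with initial terms $x_1,x_2$ and $$x_n=\frac{x_{n-1}^{b}+1}{x_{n-2}}\ (n\text{ odd}),\qquad x_n=\frac{x_{n-1}^{c}+1}{x_{n-2}}\ (n\text{ even}),$$ where for $n\le 0$ the recurrence is run backwards. Write $x_n^{(b,c)}(u,v)$ for the sequence with first two terms $u,v$. **The graphs $G_n$, $n\in\mathbb{Z}\setminus\{1,2\}$.** Place octagons in a horizontal row, numbered by consecutive integers $k$ from left to right; each octagon has two horizontal, two vertical and four diagonal edges. The square $R_k$ lies between the positions of the octagons $k-1$ and $k$ and shares its vertical edges with them (when they are present). A northern (southern) square at $k$ shares the top (bottom) edge of the octagon $k$. Let $N_k^{W},N_k^{E}$ (and $S_k^{W},S_k^{E}$) be the left and right ends of the top (bottom) edge of the octagon $k$. * $G_{2m+3}$, $m\ge 0$: octagons $1-m\le k\le 0$ (none if $m=0$); squares $R_k$ for $1-m\le k\le 1$; at each octagon $k$ a southern square if $k$ is even and a northern one if $k$ is odd. For $2-m\le k\le 0$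 an arc joins the $E$-ends, at $k$ and at $k-1$, of the octagon edges carrying the northern or southern squares. * $G_{-2m+1}$, $m\ge 1$: octagons $1-m\le k\le 0$; squares $R_k$ for $2-m\le k\le 0$; at each octagon $k$ a northern square if $k$ is even and a southern one if $k$ is odd. For $2-m\le k\le 0$ an arc joins the $W$-ends, at $k$ and at $k-1$, of the octagon edges carrying the northern or southern squares. * $G_{2m+4}$, $m\ge 0$: octagons $-m\le k\le m$; squares $R_k$ for $-m\le k\le m+1$; for $k\le 0$ a northern square at $k$ if $k$ is even and a southern one if $k$ is odd; for $k\ge 0$ a southern square if $k$ is even and a northern one if $k$ is odd (so the octagon $0$ has both). For $1-m\le k\le 0$ an arc joins $N^E$ of the even one to $S^E$ of the odd one of $k,k-1$; for $1\le k\le m$ an arc joins $S^W$ of the even one to $N^W$ of the odd one of $k,k-1$. * $G_{-2m}$, $m\ge 0$: octagons $-m\le k\le m$; squares $R_k$ for $1-m\le k\le m$; the same northern and southern squares as in $G_{2m+4}$ at $k\ne 0$, and none at $k=0$. For $1-m\le k\le 0$ an arc joins $N^W$ of the even one to $S^W$ of the odd one of $k,k-1$; for $1\le k\le m$ an arc joins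 $S^E$ of the even one to $N^E$ of the odd one of $k,k-1$. **Weights.** Every diagonal edge has weight $x_1$. Each square has exactly one edge of weight $x_2$: for a northern or southern square it is the vertical edge on the side opposite to that of the arc-ends (for the squares at $k$ in $G_{2m+3}$ the left, in $G_{-2m+1}$ the right; in $G_{2m+4}$ the left for the squares given for $k\le0$ and the right for those given for $k\ge0$; in $G_{-2m}$ the right for $k<0$ and the left for $k>0$); for $R_k$ it is the top edge if $k$ is even and the bottom edge if $k$ is odd, except in $G_{2m+4}$, where it is the bottom edge if $k$ is even and the top edge if $k$ is odd. All other edges, the arcs included, have weight $1$. Let $p_n(x_1,x_2)$ be the sum, over all perfect matchings of $G_n$, of the product of the weights of the edges in the matching, and put $$sq(n)=\begin{cases}|n-1|-1&n\text{ odd}\\|2n-2|-2&n\text{ even,}\end{cases}\qquad oct(n)=\begin{cases}\left|\tfrac n2-1\right|-\tfrac12&n\text{ odd}\\|n-2|-1&n\text{ even.}\end{cases}$$ **Theorem.** Let $(b,c)=(1,4)$. All terms $x_n$, $n\in\mathbb{Z}$, are non-zero and satisfy the recurrence for every integer $n$, and $$x_n=\frac{p_n(x_1,x_2)}{x_1^{sq(n)}\,x_2^{oct(n)}}\qquad(n\ne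 1,2).$$ For $n\neq1,2$, $sq(n)$ and $oct(n)$ are the numbers of squares and octagons of $G_n$. The coefficients of $p_n$ are non-negative, and every $x_n$, $n\in\mathbb{Z}$, is a Laurent polynomial in $x_1,x_2$ whose non-zero coefficients are positive integers. Moreover $x^{(b,c)}_{-n}(x_1,x_2)=x^{(c,b)}_{n+3}(x_2,x_1)$ for all positive integers $b,c$ and all $n\in\mathbb{Z}$. Consequently, for $(b,c)=(4,1)$ all terms are non-zero and satisfy the recurrence for every integer $n$, $$x^{(4,1)}_n(x_1,x_2)=\frac{p_{3-n}(x_2,x_1)}{x_2^{sq(3-n)}\,x_1^{oct(3-n)}}\qquad(n\neq1,2),$$ and every $x_n^{(4,1)}$ is a Laurent polynomial in $x_1,x_2$ whose non-zero coefficients are positive integers. -/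

import Mathlib

open Finset

/-- Lattice points of the plane; all graphs below are drawn on them. -/
abbrev Pt := ℤ × ℤ

/-- A finite graph with weighted edges. Edges are unordered pairs. -/
structure WeightedGraph (V R : Type*) where
  verts : Finset V
  edges : Finset (Sym2 V)
  weight : Sym2 V → R

namespace WeightedGraph

variable {V R : Type*} [DecidableEq V]

/-- A perfect matching is a set of edges such that each vertex belongs to exactly one of them. -/
def IsPerfectMatching (G : WeightedGraph V R) (S : Finset (Sym2 V)) : Prop :=
  S ⊆ G.edges ∧ ∀ v ∈ G.verts, ∃! e, e ∈ S ∧ v ∈ e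

open Classical in
/-- The finite set of all perfect matchings. -/
noncomputable def perfectMatchings (G : WeightedGraph V R) : Finset (Finset (Sym2 V)) :=
  G.edges.powerset.filter G.IsPerfectMatching

/-- The sum, over all perfect matchings, of the product of the weights of the edges used. -/
noncomputable def matchingSum [CommSemiring R] (G : WeightedGraph V R) : R :=
  ∑ S ∈ G.perfectMatchings, ∏ e ∈ S, G.weight e

end WeightedGraph

/-- The two horizontal and two vertical edges of the octagon whose bounding box has
lower left corner `p` (and side length `3`). -/
def octagonAxisEdges (p : Pt) : Finset (Sym2 Pt) :=
  {s((p.1 + 1, p.2), (p.1 + 2, p.2)), s((p.1 + 1, p.2 + 3), (p.1 + 2, p.2 + 3)),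
   s((p.1, p.2 + 1), (p.1, p.2 + 2)), s((p.1 + 3, p.2 + 1), (p.1 + 3, p.2 + 2))}

/-- The four diagonal edges of the same octagon. -/
def octagonDiagonals (p : Pt) : Finset (Sym2 Pt) :=
  {s((p.1, p.2 + 1), (p.1 + 1, p.2)), s((p.1 + 2, p.2), (p.1 + 3, p.2 + 1)),
   s((p.1 + 3, p.2 + 2), (p.1 + 2, p.2 + 3)), s((p.1 + 1, p.2 + 3), (p.1, p.2 + 2))}

/-- The four edges of the unit square with lower left corner `p`. -/
def squareEdges (p : Pt) : Finset (Sym2 Pt) :=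
  {s((p.1, p.2), (p.1 + 1, p.2)), s((p.1, p.2 + 1), (p.1 + 1, p.2 + 1)),
   s((p.1, p.2), (p.1, p.2 + 1)), s((p.1 + 1, p.2), (p.1 + 1, p.2 + 1))}

/-- The data of a graph built from octagons and squares (each given by its lower left corner)
and extra arcs, with a record of the square edges that get weight `x₂`. -/
structure CellGraph where
  octagons : Finset Pt
  squares : Finset Pt
  arcs : Finset (Sym2 Pt)
  x2Edges : Finset (Sym2 Pt)

namespace CellGraph

/-- The diagonal edges; these get weight `x₁`. -/
def diagonals (C : CellGraph) : Finset (Sym2 Pt) := C.octagons.biUnion octagonDiagonals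

def edges (C : CellGraph) : Finset (Sym2 Pt) :=
  C.diagonals ∪ C.octagons.biUnion octagonAxisEdges ∪ C.squares.biUnion squareEdges ∪ C.arcs

/-- The weighted graph: `X 0` is `x₁` and `X 1` is `x₂`. -/
noncomputable def toWeightedGraph (C : CellGraph) :
    WeightedGraph Pt (MvPolynomial (Fin 2) ℤ) where
  verts := C.edges.biUnion Sym2.toFinset
  edges := C.edges
  weight e :=
    if e ∈ C.diagonals then MvPolynomial.X 0
    else if e ∈ C.x2Edges then MvPolynomial.X 1
    else 1

end CellGraph

/-- The octagon number `k` (counted from left to right; it occupies `4k ≤ x ≤ 4k + 3`,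
`0 ≤ y ≤ 3`). -/
def octAt (k : ℤ) : Pt := (4 * k, 0)

/-- The square between the positions of the octagons `k - 1` and `k`. It shares its left edge with
the eastern edge of the octagon `k - 1` and its right edge with the western edge of the
octagon `k`. -/
def rowSquare (k : ℤ) : Pt := (4 * k - 1, 1)

/-- The top (`t = true`) or bottom (`t = false`) edge of `rowSquare k`. -/
def rowEdge (t : Bool) (k : ℤ) : Sym2 Pt :=
  if t then s((4 * k - 1, 2), (4 * k, 2)) else s((4 * k - 1, 1), (4 * k, 1))

/-- The square attached to the northern (`t = true`) or southern (`t = false`) edge of the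
octagon `k`. -/
def sideSquare (t : Bool) (k : ℤ) : Pt := if t then (4 * k + 1, 3) else (4 * k + 1, -1)

/-- The left vertical edge of `sideSquare t k`. -/
def sideLeftEdge (t : Bool) (k : ℤ) : Sym2 Pt :=
  if t then s((4 * k + 1, 3), (4 * k + 1, 4)) else s((4 * k + 1, -1), (4 * k + 1, 0))

/-- The right vertical edge of `sideSquare t k`. -/
def sideRightEdge (t : Bool) (k : ℤ) : Sym2 Pt :=
  if t then s((4 * k + 2, 3), (4 * k + 2, 4)) else s((4 * k + 2, -1), (4 * k + 2, 0))

/-- The left end of the northern (`t = true`) or southern (`t = false`) edge of the octagon `k`. It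
is the southwest (northwest) corner of `sideSquare t k`, whether or not that square is present. -/
def leftCorner (t : Bool) (k : ℤ) : Pt := if t then (4 * k + 1, 3) else (4 * k + 1, 0)

/-- The right end of the northern (`t = true`) or southern (`t = false`) edge of the
octagon `k`. -/
def rightCorner (t : Bool) (k : ℤ) : Pt := if t then (4 * k + 2, 3) else (4 * k + 2, 0)

/-- The truth value of `k` being even (odd). -/
def isEven (k : ℤ) : Bool := decide (Even k)
def isOdd (k : ℤ) : Bool := decide (Odd k)

/-- The graph `G_{2N+3}`. It has the octagons `1 - N, …, 0`, squares between consecutive octagons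
and at both ends of the row, and one more square at each octagon: at the south for the easternmost
octagon `0` and then alternately at the north and south. An arc joins the eastern corners, lying on
the octagons, of the northern and southern squares of each two consecutive octagons. The vertical
edges of weight `x₂` are those away from the arcs; the horizontal ones alternate between bottom and
top, with bottom at the eastern end. For `N = 0` it is a single square. -/
noncomputable def graphA (N : ℕ) : CellGraph where
  octagons := (Icc (1 - N : ℤ) 0).image octAt
  squares := (Icc (1 - N : ℤ) 1).image rowSquare ∪
    (Icc (1 - N : ℤ) 0).image (fun k => sideSquare (isOdd k) k)
  arcs := (Icc (2 - N : ℤ) 0).image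
    (fun k => s(rightCorner (isOdd k) k, rightCorner (isOdd (k - 1)) (k - 1)))
  x2Edges := (Icc (1 - N : ℤ) 1).image (fun k => rowEdge (isEven k) k) ∪
    (Icc (1 - N : ℤ) 0).image (fun k => sideLeftEdge (isOdd k) k)

/-- The graph `G_{-2N+1}`, for `N ≥ 1`. It has the octagons `1 - N, …, 0`, squares between
consecutive octagons but not at the ends of the row, and one more square at each octagon: at the
north for the easternmost octagon `0` and then alternately at the south and north. The arcs join
the western corners, and the vertical edges of weight `x₂` are the eastern ones; the horizontal ones
alternate between top and bottom, with top at the eastern end. -/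
noncomputable def graphD (N : ℕ) : CellGraph where
  octagons := (Icc (1 - N : ℤ) 0).image octAt
  squares := (Icc (2 - N : ℤ) 0).image rowSquare ∪
    (Icc (1 - N : ℤ) 0).image (fun k => sideSquare (isEven k) k)
  arcs := (Icc (2 - N : ℤ) 0).image
    (fun k => s(leftCorner (isEven k) k, leftCorner (isEven (k - 1)) (k - 1)))
  x2Edges := (Icc (2 - N : ℤ) 0).image (fun k => rowEdge (isEven k) k) ∪
    (Icc (1 - N : ℤ) 0).image (fun k => sideRightEdge (isEven k) k)

/-- The graph `G_{2N+4}`. It has the octagons `-N, …, N`, squares between consecutive octagons and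
at both ends of the row, two more squares (north and south) at the central octagon `0`, and one
more square at each other octagon, alternately at the north and south on either side of the
centre. The arcs are shifted towards the centre, the vertical edges of weight `x₂` are away from
them, and the horizontal ones alternate between top and bottom. The graph is symmetric under rotation by a half
turn about the centre of the octagon `0`. -/
noncomputable def graphB (N : ℕ) : CellGraph where
  octagons := (Icc (-N : ℤ) N).image octAt
  squares := (Icc (-N : ℤ) (N + 1)).image rowSquare ∪
    (Icc (-N : ℤ) 0).image (fun k => sideSquare (isEven k) k) ∪
    (Icc (0 : ℤ) N).image (fun k => sideSquare (isOdd k) k)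
  arcs := (Icc (1 - N : ℤ) 0).image
      (fun k => s(rightCorner (isEven k) k, rightCorner (isEven (k - 1)) (k - 1))) ∪
    (Icc (1 : ℤ) N).image
      (fun k => s(leftCorner (isOdd k) k, leftCorner (isOdd (k - 1)) (k - 1)))
  x2Edges := (Icc (-N : ℤ) (N + 1)).image (fun k => rowEdge (isOdd k) k) ∪
    (Icc (-N : ℤ) 0).image (fun k => sideLeftEdge (isEven k) k) ∪
    (Icc (0 : ℤ) N).image (fun k => sideRightEdge (isOdd k) k)

/-- The graph `G_{-2N}`. It has the octagons `-N, …, N`, squares between consecutive octagons but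
not at the ends of the row, no more squares at the central octagon `0`, and one more square at each
other octagon, alternately at the south and north on either side of the centre. The arcs are
shifted towards the outside, the vertical edges of weight `x₂` are away from them, and the
horizontal ones alternate between top and bottom. The graph is symmetric under rotation by a half turn about the centre
of the octagon `0`. For `N = 0` it is a single octagon. -/
noncomputable def graphC (N : ℕ) : CellGraph where
  octagons := (Icc (-N : ℤ) N).image octAt
  squares := (Icc (1 - N : ℤ) N).image rowSquare ∪
    (Icc (-N : ℤ) (-1)).image (fun k => sideSquare (isEven k) k) ∪
    (Icc (1 : ℤ) N).image (fun k => sideSquare (isOdd k) k)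
  arcs := (Icc (1 - N : ℤ) 0).image
      (fun k => s(leftCorner (isEven k) k, leftCorner (isEven (k - 1)) (k - 1))) ∪
    (Icc (1 : ℤ) N).image
      (fun k => s(rightCorner (isOdd k) k, rightCorner (isOdd (k - 1)) (k - 1)))
  x2Edges := (Icc (1 - N : ℤ) N).image (fun k => rowEdge (isEven k) k) ∪
    (Icc (-N : ℤ) (-1)).image (fun k => sideRightEdge (isEven k) k) ∪
    (Icc (1 : ℤ) N).image (fun k => sideLeftEdge (isOdd k) k)

/-- The graph `G_n`; the values at `n = 1` and `n = 2` are meaningless. -/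
noncomputable def clusterGraph (n : ℤ) : CellGraph :=
  if Odd n then
    if 3 ≤ n then graphA ((n - 3) / 2).toNat else graphD ((1 - n) / 2).toNat
  else
    if 4 ≤ n then graphB ((n - 4) / 2).toNat else graphC (-n / 2).toNat

/-- The polynomial `p_n`, the weighted sum over all perfect matchings of `G_n`. -/
noncomputable def matchingPoly (n : ℤ) : MvPolynomial (Fin 2) ℤ :=
  (clusterGraph n).toWeightedGraph.matchingSum

/-- The exponent of `x₁` in the denominator. -/
def sqNum (n : ℤ) : ℤ := if Odd n then |n - 1| - 1 else |2 * n - 2| - 2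

/-- The exponent of `x₂` in the denominator; for odd `n` it is `|n/2 - 1| - 1/2`. -/
def octNum (n : ℤ) : ℤ := if Odd n then (|n - 2| - 1) / 2 else |n - 2| - 1

/-- The field of rational functions in `x₁` and `x₂` with rational coefficients. -/
abbrev RatFun := FractionRing (MvPolynomial (Fin 2) ℤ)

noncomputable def x₁ : RatFun := algebraMap (MvPolynomial (Fin 2) ℤ) RatFun (MvPolynomial.X 0)
noncomputable def x₂ : RatFun := algebraMap (MvPolynomial (Fin 2) ℤ) RatFun (MvPolynomial.X 1)

section

variable {F : Type*} [Field F]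

/-- The pair `(x_{m+1}, x_{m+2})` of the recurrence run forwards. -/
def forwardPair (b c : ℕ) (u v : F) : ℕ → F × F
  | 0 => (u, v)
  | m + 1 =>
    let p := forwardPair b c u v m
    (p.2, (p.2 ^ (if Odd (m + 3) then b else c) + 1) / p.1)

/-- The pair `(x_{1-m}, x_{2-m})` of the recurrence run backwards. -/
def backwardPair (b c : ℕ) (u v : F) : ℕ → F × F
  | 0 => (u, v)
  | m + 1 =>
    let p := backwardPair b c u v m
    ((p.1 ^ (if Odd m then b else c) + 1) / p.2, p.1)

/-- The term `x_n^{(b,c)}(u, v)`, for any integer `n`, of the sequence with first and second term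
`u` and `v` and `x_n = (x_{n-1}^b + 1) / x_{n-2}` for odd `n`, `x_n = (x_{n-1}^c + 1) / x_{n-2}`
for even `n`. As `x_n` is a rational function of its first two terms, `x_n(u, v)` is the term of the
sequence that starts from `u` and `v`. -/
def clusterSeq (b c : ℕ) (u v : F) (n : ℤ) : F :=
  if 1 ≤ n then (forwardPair b c u v (n - 1).toNat).1
  else (backwardPair b c u v (1 - n).toNat).1

end

/-- `f` is a Laurent polynomial in `x₁`, `x₂` all of whose nonzero coefficients are positive
integers: a finite sum of terms `a (i, j) * x₁ ^ i * x₂ ^ j`. -/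
def IsPositiveLaurent (f : RatFun) : Prop :=
  ∃ a : ℤ × ℤ →₀ ℕ, f = a.sum fun e m => (m : RatFun) * x₁ ^ e.1 * x₂ ^ e.2

/-!
Write `s`, `y` for the two variables.

*Matchings.* In each of the four families, the odd (or the even) octagons can be reflected
vertically so that all octagons of a row look the same, up to the presence of the squares at the
south and north; then every graph is a finite part of an infinite row in which consecutive octagons
are joined by three edges, the horizontal edges of a square and an arc. The matching sum is the
Hafnian of the weights extended by zero to non-edges (`matchingSum_toCellGraph`), and Hafnians of a
disjoint union with few crossing edges split (`hafnian_union`). As the graphs are bipartite, only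
three sets of crossing edges occur between two octagons, so a row is described by a state of three
sums (`boundaryState`), which each octagon transforms linearly, by a matrix found by listing the
matchings of a single octagon with its squares (`blockExponents`). Along a run of octagons of the
same kind the state is expressed by two successive values of a solution of
`g (n + 2) = (s ^ 4 + (1 + y) ^ 2) * g (n + 1) - s ^ 4 * y ^ 2 * g n`
(`rowState_south_run`, `rowState_north_run`). This gives the matching polynomials of the four
families in terms of the solution `growth` with initial values `0` and `1`.

*Algebra.* The recurrence has the conserved quantity `growth_invariant`, a quadratic form in two
successive values. Clearing the monomial denominators turns the relations of the sequence into
polynomial identities between the matching polynomials, such as `numA_succ_mul`, and each of these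
is a consequence of the conserved quantity. All matching polynomials have constant coefficient `1`,
so the quotients do not vanish and agree with the terms of the sequence
(`clusterSeq_eq_of_recurrence`). Positivity holds since the matching sum is a sum of monomials, and
the case of the exponents `(4, 1)` follows by reversing the sequence (`clusterSeq_neg`).
-/

/-! ### Hafnians -/

section Hafnian

variable {α β R : Type*} [DecidableEq α] [DecidableEq β] [CommRing R]

open Classical in
/-- The perfect matchings of the complete graph on `V`. -/
noncomputable def pairings (V : Finset α) : Finset (Finset (Sym2 α)) :=
  (V.sym2.filter fun e => ¬ e.IsDiag).powerset.filter fun S => ∀ v ∈ V, ∃! e, e ∈ S ∧ v ∈ e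

theorem mem_pairings {V : Finset α} {S : Finset (Sym2 α)} :
    S ∈ pairings V ↔
      (∀ e ∈ S, ¬ e.IsDiag ∧ ∀ x ∈ e, x ∈ V) ∧ ∀ v ∈ V, ∃! e, e ∈ S ∧ v ∈ e := by
  simp only [pairings, mem_filter, mem_powerset, subset_iff, mem_sym2_iff]
  constructor
  · rintro ⟨h, h'⟩
    exact ⟨fun e he => ⟨(h he).2, (h he).1⟩, h'⟩
  · rintro ⟨h, h'⟩
    exact ⟨fun e he => ⟨(h e he).2, (h e he).1⟩, h'⟩

/-- The Hafnian of the weight function `w` on `V`: the sum, over all perfect matchings of the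
complete graph on `V`, of the product of the weights. A graph on `V` is encoded by weights that
vanish outside its edges. -/
noncomputable def hafnian (w : Sym2 α → R) (V : Finset α) : R :=
  ∑ S ∈ pairings V, ∏ e ∈ S, w e

theorem hafnian_empty (w : Sym2 α → R) : hafnian w ∅ = 1 := by
  have : pairings (∅ : Finset α) = {∅} := by
    ext S
    rw [mem_pairings, mem_singleton]
    constructor
    · rintro ⟨h, -⟩
      refine eq_empty_of_forall_notMem fun e he => ?_
      induction e with
      | _ a b => exact absurd ((h _ he).2 a (Sym2.mem_mk_left a b)) (notMem_empty a)
    · rintro rfl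
      simp
  simp [hafnian, this]

/-- Expansion of the Hafnian along the partner of the vertex `v`. -/
theorem hafnian_expand (w : Sym2 α → R) {V : Finset α} {v : α} (hv : v ∈ V) :
    hafnian w V = ∑ u ∈ V.erase v, w s(v, u) * hafnian w ((V.erase v).erase u) := by
  have hnot : ∀ u, ∀ S ∈ pairings ((V.erase v).erase u), ∀ e ∈ S, v ∉ e ∧ u ∉ e := by
    intro u S hS e he
    constructor
    · intro h
      have := (((mem_pairings.1 hS).1 e he).2 v h)
      simp at this
    · intro h
      have := (((mem_pairings.1 hS).1 e he).2 u h)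
      simp at this
  simp only [hafnian, mul_sum]
  rw [sum_sigma']
  symm
  refine sum_bij (fun x _ => insert s(v, x.1) x.2) ?_ ?_ ?_ ?_
  · rintro ⟨u, S⟩ hx
    obtain ⟨hu, hS⟩ := mem_sigma.1 hx
    dsimp only at hu hS ⊢
    obtain ⟨huv, huV⟩ := mem_erase.1 hu
    have hn := hnot u S hS
    obtain ⟨h1, h2⟩ := mem_pairings.1 hS
    refine mem_pairings.2 ⟨?_, ?_⟩
    · intro e he
      rcases mem_insert.1 he with rfl | he
      · refine ⟨by simpa using huv.symm, ?_⟩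
        intro x hx
        rcases Sym2.mem_iff.1 hx with rfl | rfl
        · exact hv
        · exact huV
      · exact ⟨(h1 e he).1, fun x hx => mem_of_mem_erase (mem_of_mem_erase ((h1 e he).2 x hx))⟩
    · intro x hx
      by_cases hxe : x ∈ s(v, u)
      · refine ⟨s(v, u), ⟨mem_insert_self _ _, hxe⟩, ?_⟩
        rintro e ⟨he, hxe'⟩
        rcases mem_insert.1 he with heq | heS
        · exact heq
        · rcases Sym2.mem_iff.1 hxe with rfl | rfl
          · exact absurd hxe' (hn e heS).1
          · exact absurd hxe' (hn e heS).2
      · have hx' : x ≠ v ∧ x ≠ u := by simpa [not_or] using hxe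
        obtain ⟨e, ⟨he, hxe'⟩, huni⟩ := h2 x (by simp [hx', hx])
        refine ⟨e, ⟨mem_insert_of_mem he, hxe'⟩, ?_⟩
        rintro e' ⟨he', hxe''⟩
        rcases mem_insert.1 he' with rfl | he'
        · exact absurd hxe'' hxe
        · exact huni e' ⟨he', hxe''⟩
  · rintro ⟨u, S⟩ hx ⟨u', S'⟩ hx' heq
    obtain ⟨hu, hS⟩ := mem_sigma.1 hx
    obtain ⟨hu', hS'⟩ := mem_sigma.1 hx'
    dsimp only at hu hS hu' hS' heq
    have hn := hnot u S hS
    have hn' := hnot u' S' hS'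
    have huu : u = u' := by
      have : s(v, u) ∈ insert s(v, u') S' := heq ▸ mem_insert_self _ _
      rcases mem_insert.1 this with h | h
      · exact Sym2.congr_right.1 h
      · exact absurd (Sym2.mem_mk_left v u) (hn' _ h).1
    subst huu
    have hSS : S = S' := by
      rw [← erase_insert (a := s(v, u)) (s := S) fun h => (hn _ h).1 (Sym2.mem_mk_left v u), heq,
        erase_insert fun h => (hn' _ h).1 (Sym2.mem_mk_left v u)]
    subst hSS
    rfl
  · intro S hS
    obtain ⟨h1, h2⟩ := mem_pairings.1 hS
    obtain ⟨e, ⟨he, hve⟩, huni⟩ := h2 v hv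
    obtain ⟨u, rfl⟩ := Sym2.mem_iff_exists.1 hve
    have huv : u ≠ v := by
      have := (h1 _ he).1
      rintro rfl
      simp at this
    have huV : u ∈ V := (h1 _ he).2 u (Sym2.mem_mk_right v u)
    have hother : ∀ e' ∈ S, e' ≠ s(v, u) → v ∉ e' ∧ u ∉ e' := by
      intro e' he' hne
      refine ⟨fun h => hne (huni e' ⟨he', h⟩), fun h => hne ?_⟩
      exact (h2 u huV).unique ⟨he', h⟩ ⟨he, Sym2.mem_mk_right v u⟩
    refine ⟨⟨u, S.erase s(v, u)⟩, mem_sigma.2 ⟨mem_erase.2 ⟨huv, huV⟩, mem_pairings.2 ⟨?_, ?_⟩⟩,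
      insert_erase he⟩
    · intro e' he'
      obtain ⟨hne, he'⟩ := mem_erase.1 he'
      refine ⟨(h1 e' he').1, fun x hx => ?_⟩
      have := hother e' he' hne
      refine mem_erase.2 ⟨?_, mem_erase.2 ⟨?_, (h1 e' he').2 x hx⟩⟩
      · rintro rfl; exact this.2 hx
      · rintro rfl; exact this.1 hx
    · intro x hx
      obtain ⟨hxu, hx⟩ := mem_erase.1 hx
      obtain ⟨hxv, hx⟩ := mem_erase.1 hx
      obtain ⟨e', ⟨he', hxe'⟩, huni'⟩ := h2 x hx
      refine ⟨e', ⟨mem_erase.2 ⟨?_, he'⟩, hxe'⟩, ?_⟩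
      · rintro rfl
        rcases Sym2.mem_iff.1 hxe' with rfl | rfl
        · exact hxv rfl
        · exact hxu rfl
      · rintro e'' ⟨he'', hx''⟩
        exact huni' e'' ⟨mem_of_mem_erase he'', hx''⟩
  · rintro ⟨u, S⟩ hx
    obtain ⟨hu, hS⟩ := mem_sigma.1 hx
    dsimp only at hu hS ⊢
    rw [prod_insert fun h => (hnot u S hS _ h).1 (Sym2.mem_mk_left v u)]

/-- The Hafnian only depends on the weights of the pairs of distinct elements. -/
theorem hafnian_congr {w w' : Sym2 α → R} {V : Finset α}
    (h : ∀ a ∈ V, ∀ b ∈ V, a ≠ b → w s(a, b) = w' s(a, b)) : hafnian w V = hafnian w' V := by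
  refine sum_congr rfl fun S hS => prod_congr rfl fun e he => ?_
  obtain ⟨h1, h2⟩ := (mem_pairings.1 hS).1 e he
  induction e with
  | _ a b =>
    exact h a (h2 a (Sym2.mem_mk_left a b)) b (h2 b (Sym2.mem_mk_right a b)) (by simpa using h1)

/-- The matching sum of a graph without loops is a Hafnian. -/
theorem matchingSum_eq_hafnian (G : WeightedGraph α R) (hdiag : ∀ e ∈ G.edges, ¬ e.IsDiag)
    (hverts : G.verts = G.edges.biUnion Sym2.toFinset) :
    G.matchingSum = hafnian (fun e => if e ∈ G.edges then G.weight e else 0) G.verts := by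
  classical
  have hsub : G.perfectMatchings ⊆ pairings G.verts := by
    intro S hS
    simp only [WeightedGraph.perfectMatchings, mem_filter, WeightedGraph.IsPerfectMatching] at hS
    refine mem_pairings.2 ⟨fun e he => ⟨hdiag e (hS.2.1 he), fun x hx => ?_⟩, hS.2.2⟩
    rw [hverts, mem_biUnion]
    exact ⟨e, hS.2.1 he, Sym2.mem_toFinset.2 hx⟩
  rw [WeightedGraph.matchingSum, hafnian, ← sum_subset hsub]
  · refine sum_congr rfl fun S hS => prod_congr rfl fun e he => ?_
    simp only [WeightedGraph.perfectMatchings, mem_filter, WeightedGraph.IsPerfectMatching] at hS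
    rw [if_pos (hS.2.1 he)]
  · intro S hS hS'
    have : ∃ e ∈ S, e ∉ G.edges := by
      by_contra! hcon
      exact hS' (mem_filter.2 ⟨mem_powerset.2 hcon, hcon, (mem_pairings.1 hS).2⟩)
    obtain ⟨e, he, heG⟩ := this
    exact prod_eq_zero he (if_neg heG)

/-- A statement about finite sets that holds for the empty set, and for a set whenever it holds for
all sets obtained by removing two elements, one of them prescribed. -/
theorem Finset.induction_erase_pair {P : Finset α → Prop} (h0 : P ∅)
    (h1 : ∀ V, ∀ v ∈ V, (∀ u ∈ V.erase v, P ((V.erase v).erase u)) → P V) (V : Finset α) : P V := by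
  induction V using Finset.strongInduction with
  | H V ih =>
    rcases V.eq_empty_or_nonempty with rfl | ⟨v, hv⟩
    · exact h0
    · refine h1 V v hv fun u hu => ih _ ?_
      exact (erase_ssubset hu).trans (erase_ssubset hv)

/-- The Hafnian is invariant under relabelling. -/
theorem hafnian_image (w : Sym2 β → R) {φ : α → β} (hφ : Function.Injective φ) (V : Finset α) :
    hafnian w (V.image φ) = hafnian (fun e => w (e.map φ)) V := by
  induction V using Finset.induction_erase_pair with
  | h0 => rw [image_empty, hafnian_empty, hafnian_empty]
  | h1 V v hv ih =>
    rw [hafnian_expand _ hv, hafnian_expand _ (mem_image_of_mem φ hv), ← image_erase hφ,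
      sum_image hφ.injOn]
    refine sum_congr rfl fun u hu => ?_
    rw [← image_erase hφ, ih u hu, Sym2.map_mk]

/-- If a charge is such that edges of non-zero weight are neutral, then so is every set with
non-zero Hafnian. -/
theorem hafnian_eq_zero_of_charge {w : Sym2 α → R} (χ : α → ℤ)
    (hχ : ∀ a b, w s(a, b) ≠ 0 → χ a + χ b = 0) {V : Finset α} (hV : ∑ v ∈ V, χ v ≠ 0) :
    hafnian w V = 0 := by
  induction V using Finset.induction_erase_pair with
  | h0 => simp at hV
  | h1 V v hv ih =>
    rw [hafnian_expand _ hv]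
    refine sum_eq_zero fun u hu => ?_
    by_cases hw : w s(v, u) = 0
    · rw [hw, zero_mul]
    · rw [ih u hu, mul_zero]
      have := hχ v u hw
      rw [← add_sum_erase _ _ hv, ← add_sum_erase _ _ hu] at hV
      intro h
      apply hV
      rw [h]
      linarith

/-- The Hafnian of a disjoint union without edges between the parts. -/
theorem hafnian_union_of_no_crossing (w : Sym2 α → R) {A B : Finset α} (hAB : Disjoint A B)
    (h : ∀ a ∈ A, ∀ b ∈ B, w s(a, b) = 0) :
    hafnian w (A ∪ B) = hafnian w A * hafnian w B := by
  induction A using Finset.induction_erase_pair with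
  | h0 => rw [empty_union, hafnian_empty, one_mul]
  | h1 A v hv ih =>
    have hvB : v ∉ B := disjoint_left.1 hAB hv
    rw [hafnian_expand w hv, hafnian_expand w (mem_union_left B hv), erase_union_distrib,
      erase_eq_of_notMem hvB, sum_union (disjoint_of_subset_left (erase_subset _ _) hAB), sum_mul,
      sum_eq_zero (s := B) fun b hb => by rw [h v hv b hb, zero_mul], add_zero]
    refine sum_congr rfl fun u hu => ?_
    have huB : u ∉ B := disjoint_left.1 hAB (mem_of_mem_erase hu)
    have hsub : (A.erase v).erase u ⊆ A := (erase_subset _ _).trans (erase_subset _ _)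
    rw [erase_union_distrib, erase_eq_of_notMem huB, ih u hu (disjoint_of_subset_left hsub hAB)
      fun a ha b hb => h a (hsub ha) b hb, mul_assoc]

/-- A perfect matching either avoids the edge between `a` and `b` or contains it. -/
theorem hafnian_delete_edge (w : Sym2 α → R) {V : Finset α} {a b : α} (ha : a ∈ V) (hb : b ∈ V)
    (hab : a ≠ b) :
    hafnian w V = hafnian (Function.update w s(a, b) 0) V +
      w s(a, b) * hafnian w ((V.erase a).erase b) := by
  have hb' : b ∈ V.erase a := mem_erase.2 ⟨hab.symm, hb⟩
  rw [hafnian_expand w ha, hafnian_expand _ ha, ← add_sum_erase _ _ hb', ← add_sum_erase _ _ hb',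
    Function.update_self, zero_mul, zero_add, add_comm]
  congr 1
  refine sum_congr rfl fun u hu => ?_
  have hub : u ≠ b := (mem_erase.1 hu).1
  rw [Function.update_of_ne fun h => hub (Sym2.congr_right.1 h)]
  congr 1
  refine hafnian_congr fun c hc d hd _ => ?_
  rw [Function.update_of_ne]
  intro h
  have : a ∈ s(c, d) := h ▸ Sym2.mem_mk_left a b
  rcases Sym2.mem_iff.1 this with rfl | rfl
  · simp at hc
  · simp at hd

/-- The Hafnian of `V` with the elements of `T` removed, or `0` if these are not all there. -/
noncomputable def hafnianDel (w : Sym2 α → R) (V T : Finset α) : R :=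
  if T ⊆ V then hafnian w (V \ T) else 0

theorem hafnianDel_empty (w : Sym2 α → R) (V : Finset α) : hafnianDel w V ∅ = hafnian w V := by
  simp [hafnianDel]

/-- Deleting vertices one at a time. -/
theorem hafnianDel_insert (w : Sym2 α → R) {V T : Finset α} {a : α} (ha : a ∈ V) (haT : a ∉ T) :
    hafnianDel w V (insert a T) = hafnianDel w (V.erase a) T := by
  have h1 : insert a T ⊆ V ↔ T ⊆ V.erase a := by
    rw [insert_subset_iff, subset_erase]
    tauto
  have h2 : V \ insert a T = V.erase a \ T := by
    ext x
    simp only [mem_sdiff, mem_insert, mem_erase]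
    tauto
  simp only [hafnianDel, h1, h2]

theorem hafnianDel_insert_of_notMem (w : Sym2 α → R) {V T : Finset α} {a : α} (ha : a ∉ V) :
    hafnianDel w V (insert a T) = 0 :=
  if_neg fun h => ha (h (mem_insert_self _ _))

theorem hafnianDel_congr {w w' : Sym2 α → R} {V T : Finset α}
    (h : ∀ a ∈ V, ∀ b ∈ V, a ≠ b → w s(a, b) = w' s(a, b)) :
    hafnianDel w V T = hafnianDel w' V T := by
  unfold hafnianDel
  split_ifs
  · exact hafnian_congr fun a ha b hb => h a (sdiff_subset ha) b (sdiff_subset hb)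
  · rfl

/-- The Hafnian of a disjoint union whose crossing edges form a matching: sum over the set `J` of
crossing edges used. -/
theorem hafnian_union {ι : Type*} [DecidableEq ι] (I : Finset ι) (f g : ι → α)
    (hf : Set.InjOn f I) (hg : Set.InjOn g I) (w : Sym2 α → R) {A B : Finset α}
    (hAB : Disjoint A B)
    (h : ∀ a ∈ A, ∀ b ∈ B, (∀ i ∈ I, ¬ (a = f i ∧ b = g i)) → w s(a, b) = 0) :
    hafnian w (A ∪ B) = ∑ J ∈ I.powerset, (∏ i ∈ J, w s(f i, g i)) *
      hafnianDel w A (J.image f) * hafnianDel w B (J.image g) := by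
  induction I using Finset.induction_on generalizing w A B with
  | empty =>
    rw [hafnian_union_of_no_crossing w hAB fun a ha b hb => h a ha b hb (by simp)]
    simp [hafnianDel_empty]
  | insert i I hi ih =>
    have hf' : Set.InjOn f I := hf.mono (by simp)
    have hg' : Set.InjOn g I := hg.mono (by simp)
    rw [sum_powerset_insert hi]
    have hfi : ∀ J ∈ I.powerset, f i ∉ J.image f := by
      intro J hJ hmem
      obtain ⟨j, hj, hji⟩ := mem_image.1 hmem
      have hjI := mem_powerset.1 hJ hj
      rw [hf (by simp [hjI]) (by simp) hji] at hjI
      exact hi hjI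
    have hgi : ∀ J ∈ I.powerset, g i ∉ J.image g := by
      intro J hJ hmem
      obtain ⟨j, hj, hji⟩ := mem_image.1 hmem
      have hjI := mem_powerset.1 hJ hj
      rw [hg (by simp [hjI]) (by simp) hji] at hjI
      exact hi hjI
    by_cases hmem : f i ∈ A ∧ g i ∈ B
    · obtain ⟨hfA, hgB⟩ := hmem
      have hgA : g i ∉ A := disjoint_right.1 hAB hgB
      have hfB : f i ∉ B := disjoint_left.1 hAB hfA
      have hne : f i ≠ g i := fun h => hgA (h ▸ hfA)
      rw [hafnian_delete_edge w (mem_union_left B hfA) (mem_union_right A hgB) hne]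
      congr 1
      · rw [ih hf' hg' _ hAB]
        · refine sum_congr rfl fun J hJ => ?_
          -- Unless the ends `f j` lie in `A`, both sides vanish; if they do, none of them is `g i`.
          by_cases hJA : J.image f ⊆ A
          swap
          · simp only [hafnianDel, if_neg hJA, mul_zero, zero_mul]
          congr 1
          · congr 1
            · refine prod_congr rfl fun j hj => ?_
              rw [Function.update_of_ne]
              intro heq
              rcases Sym2.eq_iff.1 heq with ⟨h1, -⟩ | ⟨h1, -⟩
              · exact hfi J hJ (mem_image.2 ⟨j, hj, h1⟩)
              · exact hgA (h1 ▸ hJA (mem_image_of_mem f hj))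
            · refine hafnianDel_congr fun a ha b hb _ => ?_
              rw [Function.update_of_ne]
              intro heq
              have : g i ∈ s(a, b) := heq ▸ Sym2.mem_mk_right _ _
              rcases Sym2.mem_iff.1 this with h | h
              · exact hgA (h ▸ ha)
              · exact hgA (h ▸ hb)
          · refine hafnianDel_congr fun a ha b hb _ => ?_
            rw [Function.update_of_ne]
            intro heq
            have : f i ∈ s(a, b) := heq ▸ Sym2.mem_mk_left _ _
            rcases Sym2.mem_iff.1 this with h | h
            · exact hfB (h ▸ ha)
            · exact hfB (h ▸ hb)
        · intro a ha b hb hI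
          by_cases hab : s(a, b) = s(f i, g i)
          · rw [hab, Function.update_self]
          · rw [Function.update_of_ne hab]
            refine h a ha b hb fun j hj => ?_
            rcases mem_insert.1 hj with rfl | hj
            · rintro ⟨rfl, rfl⟩
              exact hab rfl
            · exact hI j hj
      · have hA' : A.erase (f i) ⊆ A := erase_subset _ _
        have hB' : B.erase (g i) ⊆ B := erase_subset _ _
        rw [erase_union_distrib, erase_union_distrib, erase_eq_of_notMem hfB,
          erase_eq_of_notMem (a := g i) fun h => hgA (hA' h),
          ih hf' hg' w (disjoint_of_subset_left hA' (disjoint_of_subset_right hB' hAB)), mul_sum]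
        · refine sum_congr rfl fun J hJ => ?_
          rw [image_insert, image_insert, hafnianDel_insert w hfA (hfi J hJ),
            hafnianDel_insert w hgB (hgi J hJ), prod_insert fun h => hi (mem_powerset.1 hJ h)]
          ring
        · intro a ha b hb hI
          refine h a (hA' ha) b (hB' hb) fun j hj => ?_
          rcases mem_insert.1 hj with rfl | hj
          · rintro ⟨rfl, -⟩
            exact notMem_erase _ _ ha
          · exact hI j hj
    · rw [ih hf' hg' w hAB, left_eq_add]
      · refine sum_eq_zero fun J _ => ?_
        rw [image_insert, image_insert]
        by_cases hfA : f i ∈ A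
        · rw [hafnianDel_insert_of_notMem w fun h => hmem ⟨hfA, h⟩, mul_zero]
        · rw [hafnianDel_insert_of_notMem w hfA, mul_zero, zero_mul]
      · intro a ha b hb hI
        refine h a ha b hb fun j hj => ?_
        rcases mem_insert.1 hj with rfl | hj
        · rintro ⟨rfl, rfl⟩
          exact hmem ⟨ha, hb⟩
        · exact hI j hj

end Hafnian

/-! ### Matchings of a row of octagons, one octagon at a time -/

section Evaluation

variable {α R : Type*} [DecidableEq α] [CommRing R]

/-- The value `s ^ i * y ^ j` of a pair of exponents `(i, j)`. -/
def bimonomial (s y : R) (e : ℕ × ℕ) : R := s ^ e.1 * y ^ e.2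

theorem bimonomial_add (s y : R) (e e' : ℕ × ℕ) :
    bimonomial s y (e + e') = bimonomial s y e * bimonomial s y e' := by
  simp only [bimonomial, Prod.fst_add, Prod.snd_add, pow_add]
  ring

/-- The weight `s ^ i * y ^ j` of an edge with exponents `(i, j)`; `none` stands for a non-edge. -/
def edgeValue (s y : R) (o : Option (ℕ × ℕ)) : R := o.elim 0 (bimonomial s y)

/-- The exponents of the weights of all perfect matchings of the graph with vertices `l` and with
edges and weights given by the table `t`, listed by the kernel-computable recursion on the partner
of the first vertex. The first explicit argument bounds the depth of the recursion and has to be at least the length of `l`. -/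
def matchingExponents (t : α → α → Option (ℕ × ℕ)) : ℕ → List α → List (ℕ × ℕ)
  | _, [] => [0]
  | 0, _ :: _ => []
  | n + 1, v :: l => l.flatMap fun u =>
      match t v u with
      | none => []
      | some e => (matchingExponents t n (l.erase u)).map (e + ·)

/-- `matchingExponents` computes Hafnians of weights that are monomials. -/
theorem hafnian_toFinset (t : α → α → Option (ℕ × ℕ)) (s y : R) (w : Sym2 α → R)
    (hw : ∀ a b, w s(a, b) = edgeValue s y (t a b)) (n : ℕ) (l : List α) (hl : l.Nodup)
    (hn : l.length ≤ n) :
    hafnian w l.toFinset = ((matchingExponents t n l).map (bimonomial s y)).sum := by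
  induction n generalizing l with
  | zero =>
    obtain rfl : l = [] := List.length_eq_zero_iff.1 (Nat.le_zero.1 hn)
    simp [hafnian_empty, matchingExponents, bimonomial]
  | succ n ih =>
    cases l with
    | nil => simp [hafnian_empty, matchingExponents, bimonomial]
    | cons v l =>
      obtain ⟨hv, hl⟩ := List.nodup_cons.1 hl
      have hvl : v ∉ l.toFinset := by simpa using hv
      rw [hafnian_expand w (v := v) (by simp), List.toFinset_cons, erase_insert hvl,
        List.sum_toFinset _ hl]
      simp only [matchingExponents, List.flatMap, List.map_flatten, List.sum_flatten, List.map_map]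
      congr 1
      refine List.map_congr_left fun u hu => ?_
      have herase : l.toFinset.erase u = (l.erase u).toFinset := by
        ext x
        simp [hl.mem_erase_iff]
      rw [herase, ih (l.erase u) (hl.erase u)
        (by rw [List.length_erase_of_mem hu]; simp at hn; omega), hw]
      simp only [Function.comp]
      cases t v u with
      | none => simp [edgeValue]
      | some e =>
        simp only [edgeValue, Option.elim, List.map_map]
        rw [← List.sum_map_mul_left]
        congr 1
        exact List.map_congr_left fun e' _ => (bimonomial_add s y e e').symm

end Evaluation

/-- The vertices of an octagon and of the two squares that may be attached to it, up to a
reflection that makes all octagons of a row look the same: `w0`, `w1`, `e0`, `e1` are the lower and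
upper ends of the western and eastern edges, `s0`, `s1`, `n0`, `n1` the left and right ends of the
southern and northern edges, and `sq0`, `sq1`, `nq0`, `nq1` the outer vertices of the squares at the
latter. -/
inductive Corner
  | w0 | w1 | e0 | e1 | s0 | s1 | n0 | n1 | sq0 | sq1 | nq0 | nq1
  deriving DecidableEq

namespace Corner

instance : Fintype Corner where
  elems := {w0, w1, e0, e1, s0, s1, n0, n1, sq0, sq1, nq0, nq1}
  complete a := by cases a <;> decide

/-- The exponents of the weights of the edges of an octagon with a southern square, whose left edge
has weight `y`, and a northern square, whose right edge has weight `y`. -/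
def edgeExp : Corner → Corner → Option (ℕ × ℕ)
  | w0, w1 | w1, w0 | e0, e1 | e1, e0 | s0, s1 | s1, s0 | n0, n1 | n1, n0 => some (0, 0)
  | w0, s0 | s0, w0 | s1, e0 | e0, s1 | e1, n1 | n1, e1 | n0, w1 | w1, n0 => some (1, 0)
  | s0, sq0 | sq0, s0 | n1, nq1 | nq1, n1 => some (0, 1)
  | sq0, sq1 | sq1, sq0 | s1, sq1 | sq1, s1 => some (0, 0)
  | nq0, nq1 | nq1, nq0 | n0, nq0 | nq0, n0 => some (0, 0)
  | _, _ => none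

theorem edgeExp_comm : ∀ a b, edgeExp a b = edgeExp b a := by decide

/-- The sign of a vertex in the bipartition of the graph. -/
def charge : Corner → ℤ
  | w0 | e1 | s1 | n0 | sq0 | nq1 => 1
  | w1 | e0 | s0 | n1 | sq1 | nq0 => -1

theorem charge_add_of_edge : ∀ a b, edgeExp a b ≠ none → charge a + charge b = 0 := by decide

/-- All vertices, in an order that keeps `matchingExponents` fast. -/
def all : List Corner := [sq0, sq1, nq0, nq1, w0, s0, s1, e0, e1, n1, n0, w1]

variable {R : Type*} [CommRing R] (s y : R)

/-- The weights of the edges between the vertices at one octagon. -/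
def blockWeight : Sym2 Corner → R :=
  Sym2.lift ⟨fun a b => edgeValue s y (edgeExp a b), fun a b => congrArg _ (edgeExp_comm a b)⟩

theorem blockWeight_mk (a b : Corner) : blockWeight s y s(a, b) = edgeValue s y (edgeExp a b) := rfl

/-- The exponents of the weights of all perfect matchings of the vertices `X` without those of
`T`. -/
def blockExponents (X T : Finset Corner) : List (ℕ × ℕ) :=
  if T ⊆ X then matchingExponents edgeExp 12 (all.filter (· ∈ X \ T)) else []

theorem hafnianDel_blockWeight (X T : Finset Corner) :
    hafnianDel (blockWeight s y) X T = ((blockExponents X T).map (bimonomial s y)).sum := by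
  unfold hafnianDel blockExponents
  split_ifs
  · rw [← hafnian_toFinset edgeExp s y _ (blockWeight_mk s y) 12]
    · congr 1
      ext a
      have : a ∈ all := by revert a; decide
      simp [this]
    · exact List.Nodup.filter _ (by decide)
    · exact (List.length_filter_le _ _).trans (by decide)
  · simp

/-- A set of vertices with unequal colour classes has no perfect matching. -/
theorem hafnianDel_blockWeight_eq_zero {X T : Finset Corner}
    (h : ∑ a ∈ X, charge a ≠ ∑ a ∈ T, charge a) : hafnianDel (blockWeight s y) X T = 0 := by
  unfold hafnianDel
  split_ifs with hT
  · refine hafnian_eq_zero_of_charge charge (fun a b hab => charge_add_of_edge a b ?_) ?_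
    · intro hnone
      rw [blockWeight_mk, hnone] at hab
      exact hab rfl
    · rw [← sum_sdiff hT] at h
      intro h0
      rw [h0, zero_add] at h
      exact h rfl
  · rfl

end Corner

open Corner

section Chain

variable {R : Type*} [CommRing R] (s y : R) (arc : ℤ → Corner)

/-- The weights of the edges from an octagon to the next one on its right, if the arc between them
joins the vertices `c`. -/
def crossWeight (c a b : Corner) : R :=
  if a = e0 ∧ b = w1 then y else if a = e1 ∧ b = w0 then 1 else if a = c ∧ b = c then 1 else 0

/-- The weights of the edges of an infinite row of octagons with all squares. The vertex `(k, a)` is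
the vertex `a` at the octagon `k`, and the arc between the octagons `k - 1` and `k` joins their
vertices `arc k`. -/
def chainWeight : Sym2 (ℤ × Corner) → R :=
  Sym2.lift ⟨fun p q =>
    if p.1 = q.1 then blockWeight s y s(p.2, q.2)
    else if q.1 = p.1 + 1 then crossWeight y (arc q.1) p.2 q.2
    else if p.1 = q.1 + 1 then crossWeight y (arc p.1) q.2 p.2
    else 0, by
      intro p q
      simp only [eq_comm (a := p.1) (b := q.1), Sym2.eq_swap (a := p.2) (b := q.2)]
      split_ifs with h1 h2 h3 <;> first | rfl | omega⟩

theorem chainWeight_same (k : ℤ) (a b : Corner) :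
    chainWeight s y arc s((k, a), (k, b)) = blockWeight s y s(a, b) := by
  simp [chainWeight]

theorem chainWeight_succ (k : ℤ) (a b : Corner) :
    chainWeight s y arc s((k - 1, a), (k, b)) = crossWeight y (arc k) a b := by
  simp [chainWeight]

theorem chainWeight_far {k l : ℤ} (h : k + 1 < l) (a b : Corner) :
    chainWeight s y arc s((k, a), (l, b)) = 0 := by
  simp only [chainWeight, Sym2.lift_mk]
  rw [if_neg (by omega), if_neg (by omega), if_neg (by omega)]

/-- The vertices `X` at the octagon `k`. -/
def cell (k : ℤ) (X : Finset Corner) : Finset (ℤ × Corner) := X.image (Prod.mk k)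

theorem mem_cell {k : ℤ} {X : Finset Corner} {p : ℤ × Corner} :
    p ∈ cell k X ↔ p.1 = k ∧ p.2 ∈ X := by
  obtain ⟨l, a⟩ := p
  simp only [cell, mem_image, Prod.mk.injEq]
  constructor
  · rintro ⟨b, hb, rfl, rfl⟩
    exact ⟨rfl, hb⟩
  · rintro ⟨rfl, ha⟩
    exact ⟨a, ha, rfl, rfl⟩

/-- All octagons of the row carry the same weights. -/
theorem hafnianDel_cell (k : ℤ) (X T : Finset Corner) :
    hafnianDel (chainWeight s y arc) (cell k X) (cell k T) = hafnianDel (blockWeight s y) X T := by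
  have hinj : Function.Injective (Prod.mk k : Corner → ℤ × Corner) := Prod.mk_right_injective k
  simp only [hafnianDel, cell, image_subset_image_iff hinj, ← image_sdiff _ _ hinj,
    hafnian_image _ hinj]
  congr 2
  ext e
  induction e with
  | _ a b => rw [Sym2.map_mk, chainWeight_same]

/-- The contribution of the edges that cross between the octagons `k - 1` and `k`. As the graph is
bipartite, only three sets of crossing edges contribute: the empty one, both edges of the square, or
the edge of weight `y` with the arc. -/
theorem hafnian_union_cell {k : ℤ} {Λ : Finset (ℤ × Corner)} (hΛ : ∀ p ∈ Λ, p.1 < k)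
    (hc : arc k = s1 ∨ arc k = n0) {X : Finset Corner} (hX : ∑ a ∈ X, charge a = 0) :
    hafnian (chainWeight s y arc) (Λ ∪ cell k X) =
      hafnian (chainWeight s y arc) Λ * hafnian (blockWeight s y) X +
      y * hafnianDel (chainWeight s y arc) Λ (cell (k - 1) {e0, e1}) *
        hafnianDel (blockWeight s y) X {w1, w0} +
      y * hafnianDel (chainWeight s y arc) Λ (cell (k - 1) {e0, arc k}) *
        hafnianDel (blockWeight s y) X {w1, arc k} := by
  have hcross : ∀ a b c,
      (∀ i : Fin 3, ¬ (a = ![e0, e1, c] i ∧ b = ![w1, w0, c] i)) →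
      crossWeight y c a b = 0 := by
    intro a b c h
    have h0 := h 0
    have h1 := h 1
    have h2 := h 2
    simp only [Matrix.cons_val] at h0 h1 h2
    simp [crossWeight, h0, h1, h2]
  set c := arc k with hcdef
  rw [hafnian_union (univ : Finset (Fin 3)) (fun i => (k - 1, ![e0, e1, c] i))
    (fun i => (k, ![w1, w0, c] i))]
  · have himg : ∀ (j : ℤ) (h : Fin 3 → Corner) (J : Finset (Fin 3)),
        J.image (fun i => (j, h i)) = cell j (J.image h) := by
      intro j h J
      rw [cell, image_image]
      rfl
    have hzero : ∀ T : Finset Corner, ∑ a ∈ T, charge a ≠ 0 →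
        hafnianDel (blockWeight s y) X T = 0 := fun T hT =>
      hafnianDel_blockWeight_eq_zero s y (by rw [hX]; exact hT.symm)
    simp only [himg, hafnianDel_cell, chainWeight_succ, ← hcdef]
    rw [show (univ : Finset (Fin 3)).powerset =
      {∅, {0}, {1}, {2}, {0, 1}, {0, 2}, {1, 2}, {0, 1, 2}} by decide]
    -- The other five sets of crossing edges leave an unbalanced set of vertices at the octagon `k`.
    have h0 : hafnianDel (blockWeight s y) X {w1} = 0 := hzero _ (by decide)
    have h1 : hafnianDel (blockWeight s y) X {w0} = 0 := hzero _ (by decide)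
    have h2 : hafnianDel (blockWeight s y) X {c} = 0 :=
      hzero _ (by rcases hc with h | h <;> rw [h] <;> decide)
    have h3 : hafnianDel (blockWeight s y) X {w0, c} = 0 :=
      hzero _ (by rcases hc with h | h <;> rw [h] <;> decide)
    have h4 : hafnianDel (blockWeight s y) X {w1, w0, c} = 0 :=
      hzero _ (by rcases hc with h | h <;> rw [h] <;> decide)
    have hcc : crossWeight y c c c = 1 := by rcases hc with h | h <;> rw [h] <;> simp [crossWeight]
    rw [sum_insert (by decide), sum_insert (by decide), sum_insert (by decide),
      sum_insert (by decide), sum_insert (by decide), sum_insert (by decide),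
      sum_insert (by decide), sum_singleton]
    simp only [image_empty, image_insert, image_singleton, Matrix.cons_val, h0, h1, h2, h3, h4,
      mul_zero, zero_add, add_zero]
    have hp : ∏ i ∈ ({0, 2} : Finset (Fin 3)),
        crossWeight y c (![e0, e1, c] i) (![w1, w0, c] i) = y := by
      rw [prod_insert (by decide), prod_singleton]
      simp only [Matrix.cons_val, hcc, mul_one]
      simp [crossWeight]
    have hp' : ∏ i ∈ ({0, 1} : Finset (Fin 3)),
        crossWeight y c (![e0, e1, c] i) (![w1, w0, c] i) = y := by
      rw [prod_insert (by decide), prod_singleton]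
      simp [crossWeight]
    rw [hp, hp', prod_empty, hafnianDel_empty, one_mul, show cell (k - 1) (∅ : Finset Corner) = ∅
      from rfl, hafnianDel_empty, add_assoc]
  · intro i _ j _ h
    simp only [Prod.mk.injEq, true_and] at h
    revert h
    rcases hc with h | h <;> rw [h] <;> revert i j <;> decide
  · intro i _ j _ h
    simp only [Prod.mk.injEq, true_and] at h
    revert h
    rcases hc with h | h <;> rw [h] <;> revert i j <;> decide
  · refine disjoint_left.2 fun p hp hp' => ?_
    have h1 := hΛ p hp
    have h2 := (mem_cell.1 hp').1
    omega
  · rintro ⟨l, a⟩ hp ⟨l', b⟩ hp' h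
    have h1 : l < k := hΛ _ hp
    obtain ⟨rfl, hb⟩ : l' = k ∧ b ∈ X := mem_cell.1 hp'
    rcases (show l = l' - 1 ∨ l + 1 < l' by omega) with rfl | hlt
    · rw [chainWeight_succ]
      refine hcross a b c fun i hi => h i (mem_univ i) ?_
      rw [← hi.1, ← hi.2]
      exact ⟨rfl, rfl⟩
    · exact chainWeight_far s y arc hlt a b

/-- What the matchings of the part `Λ` of the row, with last octagon `k`, contribute to those of a
longer row: the sums over the matchings of `Λ`, of `Λ` without the eastern edge of the octagon `k`,
and of `Λ` without the lower end of that edge and the end `c` of an arc. -/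
noncomputable def boundaryState (Λ : Finset (ℤ × Corner)) (k : ℤ) (c : Corner) : R × R × R :=
  (hafnian (chainWeight s y arc) Λ, hafnianDel (chainWeight s y arc) Λ (cell k {e0, e1}),
    hafnianDel (chainWeight s y arc) Λ (cell k {e0, c}))

theorem boundaryState_empty (k : ℤ) (c : Corner) : boundaryState s y arc ∅ k c = (1, 0, 0) := by
  simp [boundaryState, hafnian_empty, hafnianDel, cell]

/-- The effect of the vertices `X` of the next octagon, where `T` are those to be omitted and `c` is
the end of the arc to the preceding octagon, on the sum over matchings. -/
def transfer (X : Finset Corner) (c : Corner) (T : Finset Corner) (v : R × R × R) : R :=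
  if T ⊆ X then
    v.1 * ((blockExponents (X \ T) ∅).map (bimonomial s y)).sum +
      y * v.2.1 * ((blockExponents (X \ T) {w1, w0}).map (bimonomial s y)).sum +
      y * v.2.2 * ((blockExponents (X \ T) {w1, c}).map (bimonomial s y)).sum
  else 0

/-- The sum over the matchings of a row after adding an octagon without the vertices `T`. -/
theorem hafnianDel_union_cell {k : ℤ} {Λ : Finset (ℤ × Corner)} (hΛ : ∀ p ∈ Λ, p.1 < k)
    (hc : arc k = s1 ∨ arc k = n0) {X T : Finset Corner}
    (hX : ∑ a ∈ X, charge a = ∑ a ∈ T, charge a) :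
    hafnianDel (chainWeight s y arc) (Λ ∪ cell k X) (cell k T) =
      transfer s y X (arc k) T (boundaryState s y arc Λ (k - 1) (arc k)) := by
  have hsub : cell k T ⊆ Λ ∪ cell k X ↔ T ⊆ X := by
    constructor
    · intro h a ha
      rcases mem_union.1 (h (mem_cell.2 ⟨rfl, ha⟩ : (k, a) ∈ cell k T)) with h | h
      · exact absurd (hΛ _ h) (lt_irrefl _)
      · exact (mem_cell.1 h).2
    · intro h p hp
      obtain ⟨h1, h2⟩ := mem_cell.1 hp
      exact mem_union_right _ (mem_cell.2 ⟨h1, h h2⟩)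
  by_cases hT : T ⊆ X
  · have hdiff : (Λ ∪ cell k X) \ cell k T = Λ ∪ cell k (X \ T) := by
      ext p
      have : p ∈ Λ → p.1 ≠ k := fun h => (hΛ p h).ne
      simp only [mem_sdiff, mem_union, mem_cell]
      tauto
    have hX' : ∑ a ∈ X \ T, charge a = 0 := by
      rw [← sum_sdiff hT] at hX
      linarith
    rw [hafnianDel, if_pos (hsub.2 hT), hdiff, hafnian_union_cell s y arc hΛ hc hX', transfer,
      if_pos hT, ← hafnianDel_empty (blockWeight s y)]
    simp only [hafnianDel_blockWeight, boundaryState]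
  · rw [hafnianDel, if_neg fun h => hT (hsub.1 h), transfer, if_neg hT]

/-- Adding an octagon transforms the state linearly. -/
theorem boundaryState_union_cell {k : ℤ} {Λ : Finset (ℤ × Corner)} (hΛ : ∀ p ∈ Λ, p.1 < k)
    (hc : arc k = s1 ∨ arc k = n0) {c : Corner} (hc' : c = s1 ∨ c = n0) {X : Finset Corner}
    (hX : ∑ a ∈ X, charge a = 0) {v : R × R × R}
    (hv : boundaryState s y arc Λ (k - 1) (arc k) = v) :
    boundaryState s y arc (Λ ∪ cell k X) k c =
      (transfer s y X (arc k) ∅ v, transfer s y X (arc k) {e0, e1} v,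
        transfer s y X (arc k) {e0, c} v) := by
  subst hv
  rw [← hafnianDel_union_cell s y arc hΛ hc (by rw [hX]; rfl),
    ← hafnianDel_union_cell s y arc hΛ hc (by rw [hX]; rfl),
    ← hafnianDel_union_cell s y arc hΛ hc
      (by rw [hX]; rcases hc' with h | h <;> rw [h] <;> rfl)]
  rw [show cell k (∅ : Finset Corner) = ∅ from rfl, hafnianDel_empty, boundaryState]

end Chain

/-! ### The possible octagons, and rows made of them -/

section Blocks

/-- The vertices of an octagon. -/
def octagonCorners : Finset Corner := {w0, w1, e0, e1, s0, s1, n0, n1}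

/-- The outer vertices of a southern square. -/
def southCorners : Finset Corner := {sq0, sq1}

/-- The outer vertices of a northern square. -/
def northCorners : Finset Corner := {nq0, nq1}

variable {R : Type*} [CommRing R] (s y u r a : R)

theorem transfer_eq {X : Finset Corner} {c : Corner} {T : Finset Corner}
    (l₀ l₁ l₂ : List (ℕ × ℕ)) (hT : T ⊆ X) (h₀ : blockExponents (X \ T) ∅ = l₀)
    (h₁ : blockExponents (X \ T) {w1, w0} = l₁) (h₂ : blockExponents (X \ T) {w1, c} = l₂) :
    transfer s y X c T (u, r, a) = u * (l₀.map (bimonomial s y)).sum +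
      y * r * (l₁.map (bimonomial s y)).sum + y * a * (l₂.map (bimonomial s y)).sum := by
  rw [transfer, if_pos hT, h₀, h₁, h₂]

theorem transfer_eq_zero {X : Finset Corner} {c : Corner} {T : Finset Corner} (hT : ¬ T ⊆ X)
    (v : R × R × R) : transfer s y X c T v = 0 := if_neg hT

/-- An octagon with a southern square, inside a run of such octagons. -/
theorem transfer_south :
    transfer s y (octagonCorners ∪ southCorners) s1 ∅ (u, r, a) =
      (s ^ 4 + 1 + y) * u + y * (1 + y) * r + y * s * a ∧
    transfer s y (octagonCorners ∪ southCorners) s1 {e0, e1} (u, r, a) =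
      (1 + y) * u + y * (1 + y) * r + y * s * a ∧
    transfer s y (octagonCorners ∪ southCorners) s1 {e0, s1} (u, r, a) = s ^ 3 * u := by
  refine ⟨?_, ?_, ?_⟩
  · rw [transfer_eq s y u r a [(4, 0), (0, 0), (0, 1)] [(0, 0), (0, 1)] [(1, 0)]
      (by decide) (by decide) (by decide) (by decide)]
    simp [bimonomial]
    ring
  · rw [transfer_eq s y u r a [(0, 0), (0, 1)] [(0, 0), (0, 1)] [(1, 0)]
      (by decide) (by decide) (by decide) (by decide)]
    simp [bimonomial]
    ring
  · rw [transfer_eq s y u r a [(3, 0)] [] [] (by decide) (by decide) (by decide) (by decide)]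
    simp [bimonomial]
    ring

/-- An octagon with a northern square, inside a run of such octagons. -/
theorem transfer_north :
    transfer s y (octagonCorners ∪ northCorners) n0 ∅ (u, r, a) =
      (s ^ 4 + 1 + y) * u + y * (1 + y) * r + y * s ^ 3 * a ∧
    transfer s y (octagonCorners ∪ northCorners) n0 {e0, e1} (u, r, a) =
      (1 + y) * u + y * (1 + y) * r ∧
    transfer s y (octagonCorners ∪ northCorners) n0 {e0, n0} (u, r, a) =
      s * u + y * s * r := by
  refine ⟨?_, ?_, ?_⟩
  · rw [transfer_eq s y u r a [(4, 0), (0, 0), (0, 1)] [(0, 0), (0, 1)] [(3, 0)]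
      (by decide) (by decide) (by decide) (by decide)]
    simp [bimonomial]
    ring
  · rw [transfer_eq s y u r a [(0, 0), (0, 1)] [(0, 0), (0, 1)] []
      (by decide) (by decide) (by decide) (by decide)]
    simp [bimonomial]
    ring
  · rw [transfer_eq s y u r a [(1, 0)] [(1, 0)] [] (by decide) (by decide) (by decide) (by decide)]
    simp [bimonomial]
    ring

/-- An octagon with two squares, after southern and before northern squares. -/
theorem transfer_both :
    transfer s y (octagonCorners ∪ southCorners ∪ northCorners) s1 ∅ (u, r, a) =
      (s ^ 4 + (1 + y) ^ 2) * u + y * (1 + y) ^ 2 * r + y * s * (1 + y) * a ∧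
    transfer s y (octagonCorners ∪ southCorners ∪ northCorners) s1 {e0, e1} (u, r, a) =
      (1 + y) ^ 2 * u + y * (1 + y) ^ 2 * r + y * s * (1 + y) * a ∧
    transfer s y (octagonCorners ∪ southCorners ∪ northCorners) s1 {e0, n0} (u, r, a) =
      s * (1 + y) * u + y * s * (1 + y) * r + y * s ^ 2 * a := by
  refine ⟨?_, ?_, ?_⟩
  · rw [transfer_eq s y u r a [(4, 0), (0, 0), (0, 1), (0, 1), (0, 2)]
      [(0, 0), (0, 1), (0, 1), (0, 2)] [(1, 0), (1, 1)]
      (by decide) (by decide) (by decide) (by decide)]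
    simp [bimonomial]
    ring
  · rw [transfer_eq s y u r a [(0, 0), (0, 1), (0, 1), (0, 2)] [(0, 0), (0, 1), (0, 1), (0, 2)]
      [(1, 0), (1, 1)] (by decide) (by decide) (by decide) (by decide)]
    simp [bimonomial]
    ring
  · rw [transfer_eq s y u r a [(1, 0), (1, 1)] [(1, 0), (1, 1)] [(2, 0)]
      (by decide) (by decide) (by decide) (by decide)]
    simp [bimonomial]
    ring

/-- An octagon with neither square, after northern and before southern squares. -/
theorem transfer_bare :
    transfer s y octagonCorners n0 ∅ (u, r, a) = (s ^ 4 + 1) * u + y * r + y * s ^ 3 * a ∧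
    transfer s y octagonCorners n0 {e0, e1} (u, r, a) = u + y * r ∧
    transfer s y octagonCorners n0 {e0, s1} (u, r, a) = s ^ 3 * u + y * s ^ 2 * a := by
  refine ⟨?_, ?_, ?_⟩
  · rw [transfer_eq s y u r a [(4, 0), (0, 0)] [(0, 0)] [(3, 0)]
      (by decide) (by decide) (by decide) (by decide)]
    simp [bimonomial]
    ring
  · rw [transfer_eq s y u r a [(0, 0)] [(0, 0)] [] (by decide) (by decide) (by decide) (by decide)]
    simp [bimonomial]
  · rw [transfer_eq s y u r a [(3, 0)] [] [(2, 0)] (by decide) (by decide) (by decide) (by decide)]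
    simp [bimonomial]
    ring

/-- The eastern edge of a missing octagon, which begins a row whose first part is a square. -/
theorem transfer_eastern :
    transfer s y {e0, e1} s1 ∅ (u, r, a) = u ∧ transfer s y {e0, e1} s1 {e0, e1} (u, r, a) = u ∧
    transfer s y {e0, e1} s1 {e0, s1} (u, r, a) = 0 := by
  refine ⟨?_, ?_, transfer_eq_zero s y (by decide) _⟩
  · rw [transfer_eq s y u r a [(0, 0)] [] [] (by decide) (by decide) (by decide) (by decide)]
    simp [bimonomial]
  · rw [transfer_eq s y u r a [(0, 0)] [] [] (by decide) (by decide) (by decide) (by decide)]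
    simp [bimonomial]

/-- The western edge of a missing octagon, which ends a row whose last part is a square. -/
theorem transfer_western {c : Corner} (hc : c = s1 ∨ c = n0) :
    transfer s y {w0, w1} c ∅ (u, r, a) = u + y * r := by
  rw [transfer_eq s y u r a [(0, 0)] [(0, 0)] [] (by decide) (by decide) (by decide)
    (by rcases hc with rfl | rfl <;> decide)]
  simp [bimonomial]

end Blocks

section Row

variable {R : Type*} [CommRing R] (s y : R) (arc : ℤ → Corner) (X : ℤ → Finset Corner) (a : ℤ)

/-- The vertices `X k` at `n` consecutive octagons `k = a, …, a + n - 1`. -/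
def row : ℕ → Finset (ℤ × Corner)
  | 0 => ∅
  | n + 1 => row n ∪ cell (a + n) (X (a + n))

theorem mem_row (n : ℕ) (p : ℤ × Corner) :
    p ∈ row X a n ↔ a ≤ p.1 ∧ p.1 < a + n ∧ p.2 ∈ X p.1 := by
  induction n with
  | zero =>
    simp only [row, notMem_empty, false_iff]
    push_cast
    omega
  | succ n ih =>
    rw [row, mem_union, ih, mem_cell]
    push_cast
    constructor
    · rintro (⟨h1, h2, h3⟩ | ⟨h1, h2⟩)
      · exact ⟨h1, by omega, h3⟩
      · exact ⟨by omega, by omega, h1 ▸ h2⟩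
    · rintro ⟨h1, h2, h3⟩
      rcases (show p.1 < a + n ∨ p.1 = a + n by omega) with h | h
      · exact Or.inl ⟨h1, h, h3⟩
      · exact Or.inr ⟨h, h ▸ h3⟩

/-- The state at the right end of the first `n` octagons of a row. -/
noncomputable def rowState (n : ℕ) (c : Corner) : R × R × R :=
  boundaryState s y arc (row X a n) (a + n - 1) c

variable {s y arc X a}

theorem hafnian_row (n : ℕ) (c : Corner) :
    hafnian (chainWeight s y arc) (row X a n) = (rowState s y arc X a n c).1 := rfl

theorem rowState_zero (c : Corner) : rowState s y arc X a 0 c = (1, 0, 0) :=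
  boundaryState_empty s y arc _ c

theorem rowState_succ {n : ℕ} {c c' : Corner} {Y : Finset Corner} {v : R × R × R}
    (hX : X (a + n) = Y) (harc : arc (a + n) = c) (hc : c = s1 ∨ c = n0) (hc' : c' = s1 ∨ c' = n0)
    (hY : ∑ b ∈ Y, charge b = 0) (hv : rowState s y arc X a n c = v) :
    rowState s y arc X a (n + 1) c' =
      (transfer s y Y c ∅ v, transfer s y Y c {e0, e1} v, transfer s y Y c {e0, c'} v) := by
  subst hX harc
  rw [rowState, row, Nat.cast_add_one, ← add_assoc, add_sub_cancel_right]
  exact boundaryState_union_cell s y arc (fun p hp => ((mem_row X a n p).1 hp).2.1) hc hc' hY hv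

variable (s y) in
/-- The recurrence `g (n + 2) = T * g (n + 1) - K * g n` with `T = s ^ 4 + (1 + y) ^ 2` and
`K = s ^ 4 * y ^ 2`, which governs the growth of the rows. -/
def SolvesRecurrence (g : ℕ → R) : Prop :=
  ∀ n, g (n + 2) = (s ^ 4 + (1 + y) ^ 2) * g (n + 1) - s ^ 4 * y ^ 2 * g n

/-- A run of octagons with southern squares. The first component of the state solves the recurrence,
and the other two are determined by it and its preceding value. -/
theorem rowState_south_run {g : ℕ → R} (hg : SolvesRecurrence s y g) {m : ℕ} (n : ℕ)
    (hrow : ∀ k, a + m ≤ k → k < a + m + n →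
      X k = octagonCorners ∪ southCorners ∧ arc k = s1)
    (h0 : rowState s y arc X a m s1 = (g 1, g 1 - s ^ 4 * g 0, s ^ 3 * g 0)) :
    rowState s y arc X a (m + n) s1 = (g (n + 1), g (n + 1) - s ^ 4 * g n, s ^ 3 * g n) := by
  induction n with
  | zero => exact h0
  | succ n ih =>
    have ih := ih fun k h1 h2 => hrow k h1 (by push_cast; omega)
    obtain ⟨hX, harc⟩ := hrow (a + (m + n : ℕ)) (by push_cast; omega) (by push_cast; omega)
    rw [← add_assoc, rowState_succ hX harc (by simp) (by simp) (by decide) ih,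
      (transfer_south s y _ _ _).1, (transfer_south s y _ _ _).2.1, (transfer_south s y _ _ _).2.2,
      hg n]
    refine Prod.ext ?_ (Prod.ext ?_ ?_) <;> ring

/-- A run of octagons with northern squares. Here the solution `h` of the recurrence is `u + y * r` in
terms of the first two components `u`, `r` of the state. -/
theorem rowState_north_run {h : ℕ → R} (hh : SolvesRecurrence s y h) {m : ℕ} (n : ℕ)
    (hrow : ∀ k, a + m ≤ k → k < a + m + n →
      X k = octagonCorners ∪ northCorners ∧ arc k = n0)
    (h0 : rowState s y arc X a m n0 = (h 1 - y * (1 + y) * h 0, (1 + y) * h 0, s * h 0)) :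
    rowState s y arc X a (m + n) n0 =
      (h (n + 1) - y * (1 + y) * h n, (1 + y) * h n, s * h n) := by
  induction n with
  | zero => exact h0
  | succ n ih =>
    have ih := ih fun k h1 h2 => hrow k h1 (by push_cast; omega)
    obtain ⟨hX, harc⟩ := hrow (a + (m + n : ℕ)) (by push_cast; omega) (by push_cast; omega)
    rw [← add_assoc, rowState_succ hX harc (by simp) (by simp) (by decide) ih,
      (transfer_north s y _ _ _).1, (transfer_north s y _ _ _).2.1, (transfer_north s y _ _ _).2.2,
      hh n]
    refine Prod.ext ?_ (Prod.ext ?_ ?_) <;> ring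

variable (s y) in
/-- The solution of the recurrence with initial values `0` and `1`. -/
def growth : ℕ → R
  | 0 => 0
  | 1 => 1
  | n + 2 => (s ^ 4 + (1 + y) ^ 2) * growth (n + 1) - s ^ 4 * y ^ 2 * growth n

theorem solvesRecurrence_growth : SolvesRecurrence s y (growth s y) := fun _ => rfl

variable (s y) in
/-- The solution of the recurrence with initial values `g₀` and `g₁`. -/
def growthFrom (g₀ g₁ : R) : ℕ → R
  | 0 => g₀
  | n + 1 => g₁ * growth s y (n + 1) - s ^ 4 * y ^ 2 * g₀ * growth s y n

theorem solvesRecurrence_growthFrom (g₀ g₁ : R) : SolvesRecurrence s y (growthFrom s y g₀ g₁) := by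
  intro n
  cases n with
  | zero => simp only [growthFrom, growth]; ring
  | succ n => simp only [growthFrom, growth]; ring

theorem growthFrom_one (g₀ g₁ : R) : growthFrom s y g₀ g₁ 1 = g₁ := by
  simp [growthFrom, growth]

/-- The state after an eastern edge and `n` octagons with southern squares. -/
theorem rowState_eastern_south (n : ℕ) (hE : X a = {e0, e1}) (harc : arc a = s1)
    (hrow : ∀ k, a + 1 ≤ k → k < a + 1 + n → X k = octagonCorners ∪ southCorners ∧ arc k = s1) :
    rowState s y arc X a (1 + n) s1 = (growth s y (n + 1),
      growth s y (n + 1) - s ^ 4 * growth s y n, s ^ 3 * growth s y n) := by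
  refine rowState_south_run solvesRecurrence_growth n (by simpa using hrow) ?_
  have h := rowState_succ (s := s) (y := y) (n := 0) (c' := s1) (by simpa using hE)
    (by simpa using harc) (by simp) (by simp) (by decide) (rowState_zero s1)
  rw [zero_add] at h
  rw [h, (transfer_eastern s y _ _ _).1, (transfer_eastern s y _ _ _).2.1,
    (transfer_eastern s y _ _ _).2.2]
  simp [growth]

/-- The state after `n` octagons with northern squares. -/
theorem rowState_north (n : ℕ)
    (hrow : ∀ k, a ≤ k → k < a + n → X k = octagonCorners ∪ northCorners ∧ arc k = n0) :
    rowState s y arc X a n n0 = (growth s y (n + 1) - y * (1 + y) * growth s y n,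
      (1 + y) * growth s y n, s * growth s y n) := by
  have := rowState_north_run (m := 0) solvesRecurrence_growth (s := s) (y := y) n
    (by simpa using hrow) ?_
  · rwa [zero_add] at this
  · simp [rowState_zero, growth]

theorem hafnian_row_succ_western {n : ℕ} {c : Corner} {u r b : R} (hW : X (a + n) = {w0, w1})
    (harc : arc (a + n) = c) (hc : c = s1 ∨ c = n0)
    (hv : rowState s y arc X a n c = (u, r, b)) :
    hafnian (chainWeight s y arc) (row X a (n + 1)) = u + y * r := by
  rw [hafnian_row _ c, rowState_succ hW harc hc hc (by decide) hv, transfer_western _ _ _ _ _ hc]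

/-- Octagons with southern squares, between two squares. -/
theorem hafnian_south_row (n : ℕ) (hE : X a = {e0, e1}) (harc : arc a = s1)
    (hrow : ∀ k, a + 1 ≤ k → k < a + 1 + n → X k = octagonCorners ∪ southCorners ∧ arc k = s1)
    (hW : X (a + n + 1) = {w0, w1}) (harc' : arc (a + n + 1) = s1) :
    hafnian (chainWeight s y arc) (row X a (n + 2)) =
      (1 + y) * growth s y (n + 1) - y * s ^ 4 * growth s y n := by
  have hcast : a + ((1 + n : ℕ) : ℤ) = a + n + 1 := by push_cast; ring
  rw [show n + 2 = 1 + n + 1 by ring, hafnian_row_succ_western (by rw [hcast, hW])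
    (by rw [hcast, harc']) (by simp) (rowState_eastern_south n hE harc hrow)]
  ring

/-- Octagons with northern squares, without squares at the ends. -/
theorem hafnian_north_row (n : ℕ)
    (hrow : ∀ k, a ≤ k → k < a + n → X k = octagonCorners ∪ northCorners ∧ arc k = n0) :
    hafnian (chainWeight s y arc) (row X a n) =
      growth s y (n + 1) - y * (1 + y) * growth s y n := by
  rw [hafnian_row n n0, rowState_north n hrow]

/-- Octagons with southern squares on the left of an octagon with two squares, and octagons with
northern squares on its right, between two squares. -/
theorem hafnian_south_north_row (n : ℕ) (hE : X a = {e0, e1}) (harc : arc a = s1)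
    (hrow : ∀ k, a + 1 ≤ k → k < a + 1 + n → X k = octagonCorners ∪ southCorners ∧ arc k = s1)
    (hmid : X (a + n + 1) = octagonCorners ∪ southCorners ∪ northCorners)
    (hmid' : arc (a + n + 1) = s1)
    (hrow' : ∀ k, a + n + 2 ≤ k → k < a + n + 2 + n →
      X k = octagonCorners ∪ northCorners ∧ arc k = n0)
    (hW : X (a + 2 * n + 2) = {w0, w1}) (harc' : arc (a + 2 * n + 2) = n0) :
    hafnian (chainWeight s y arc) (row X a (2 * n + 3)) =
      s ^ 4 * growth s y (n + 1) ^ 2 +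
        (growth s y (n + 2) - s ^ 4 * growth s y (n + 1)) ^ 2 := by
  -- The state after the octagon with two squares starts a northern run with these initial values.
  set h₀ := growth s y (n + 2) - s ^ 4 * growth s y (n + 1) with hh₀
  set h₁ := s ^ 4 * growth s y (n + 1) + (1 + y) ^ 2 * h₀ with hh₁
  have hgr := solvesRecurrence_growth (s := s) (y := y) n
  have hcast : a + ((1 + n : ℕ) : ℤ) = a + n + 1 := by push_cast; ring
  have hcast₂ : a + ((1 + n + 1 : ℕ) : ℤ) = a + n + 2 := by push_cast; ring
  have hcast₃ : a + ((1 + n + 1 + n : ℕ) : ℤ) = a + 2 * n + 2 := by push_cast; ring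
  have hstate := rowState_succ (c' := n0) (by rw [hcast, hmid]) (by rw [hcast, hmid']) (by simp)
    (by simp) (by decide) (rowState_eastern_south (s := s) (y := y) n hE harc hrow)
  rw [(transfer_both s y _ _ _).1, (transfer_both s y _ _ _).2.1,
    (transfer_both s y _ _ _).2.2] at hstate
  have hrun := rowState_north_run (solvesRecurrence_growthFrom (s := s) (y := y) h₀ h₁) n
    (by rwa [hcast₂]) (hstate.trans ?_)
  · rw [show 2 * n + 3 = 1 + n + 1 + n + 1 by ring, hafnian_row_succ_western
      (by rw [hcast₃, hW]) (by rw [hcast₃, harc']) (by simp) hrun]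
    simp only [growthFrom]
    rw [hh₁, hh₀, hgr]
    ring
  · rw [growthFrom_one, growthFrom, hh₁, hh₀, hgr]
    refine Prod.ext ?_ (Prod.ext ?_ ?_) <;> ring

/-- Octagons with northern squares on the left of an octagon without northern or southern squares,
and octagons with southern squares on its right, without squares at the ends. -/
theorem hafnian_north_south_row (n : ℕ)
    (hrow : ∀ k, a ≤ k → k < a + n → X k = octagonCorners ∪ northCorners ∧ arc k = n0)
    (hmid : X (a + n) = octagonCorners) (hmid' : arc (a + n) = n0)
    (hrow' : ∀ k, a + n + 1 ≤ k → k < a + n + 1 + n →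
      X k = octagonCorners ∪ southCorners ∧ arc k = s1) :
    hafnian (chainWeight s y arc) (row X a (2 * n + 1)) =
      s ^ 4 * (growth s y (n + 1) - y ^ 2 * growth s y n) ^ 2 + growth s y (n + 1) ^ 2 := by
  -- The state after the octagon without such squares starts a southern run with these initial
  -- values.
  set g₀ := growth s y (n + 1) - y ^ 2 * growth s y n with hg₀
  set g₁ := s ^ 4 * g₀ + growth s y (n + 1) with hg₁
  have hcast : a + ((n + 1 : ℕ) : ℤ) = a + n + 1 := by push_cast; ring
  have hstate := rowState_succ (c' := s1) hmid hmid' (by simp) (by simp) (by decide)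
    (rowState_north (s := s) (y := y) n hrow)
  rw [(transfer_bare s y _ _ _).1, (transfer_bare s y _ _ _).2.1,
    (transfer_bare s y _ _ _).2.2] at hstate
  have hrun := rowState_south_run (solvesRecurrence_growthFrom (s := s) (y := y) g₀ g₁) n
    (by rwa [hcast]) (hstate.trans ?_)
  · rw [show 2 * n + 1 = n + 1 + n by ring, hafnian_row _ s1, hrun]
    simp only [growthFrom]
    rw [hg₁, hg₀]
    ring
  · rw [growthFrom_one, growthFrom, hg₁, hg₀]
    refine Prod.ext ?_ (Prod.ext ?_ ?_) <;> ring

end Row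

/-! ### The edges at one octagon -/

namespace Corner

/-- The first coordinate of a vertex relative to the lower left corner of its octagon. -/
def xOffset : Corner → ℤ
  | w0 | w1 => 0
  | s0 | n0 | sq0 | nq0 => 1
  | s1 | n1 | sq1 | nq1 => 2
  | e0 | e1 => 3

/-- The second coordinate of a vertex relative to the lower left corner of its octagon. -/
def yOffset : Corner → ℤ
  | sq0 | sq1 => -1
  | s0 | s1 => 0
  | w0 | e0 => 1
  | w1 | e1 => 2
  | n0 | n1 => 3
  | nq0 | nq1 => 4

theorem offset_injective : ∀ a b, xOffset a = xOffset b → yOffset a = yOffset b → a = b := by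
  decide

theorem xOffset_bounds : ∀ a, 0 ≤ xOffset a ∧ xOffset a ≤ 3 := by decide

/-- The diagonal edges of an octagon. -/
def diagonalEdges : Finset (Sym2 Corner) := {s(w0, s0), s(s1, e0), s(e1, n1), s(n0, w1)}

/-- The horizontal and vertical edges of an octagon. -/
def axisEdges : Finset (Sym2 Corner) := {s(s0, s1), s(n0, n1), s(w0, w1), s(e0, e1)}

/-- The edges of a southern square. -/
def southEdges : Finset (Sym2 Corner) := {s(sq0, sq1), s(s0, s1), s(sq0, s0), s(sq1, s1)}

/-- The edges of a northern square. -/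
def northEdges : Finset (Sym2 Corner) := {s(n0, n1), s(nq0, nq1), s(n0, nq0), s(n1, nq1)}

/-- Whether a vertex is present at an octagon. The arguments tell whether the octagon `o` itself,
the squares `r` on its left and `r'` on its right, its southern square `t` and its northern square
`u` are present. -/
def present (o r r' t u : Bool) : Corner → Bool
  | w0 | w1 => o || r
  | e0 | e1 => o || r'
  | s0 | s1 | n0 | n1 => o
  | sq0 | sq1 => t
  | nq0 | nq1 => u

/-- Two vertices that are present are joined by an edge of a part that is present if and only if the
table `edgeExp` says so, and then the weights agree. -/
theorem mem_edges_iff_of_present : ∀ o r r' t u : Bool, (t → o) → (u → o) → ∀ a b,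
    present o r r' t u a → present o r r' t u b →
      ((o = true ∧ s(a, b) ∈ diagonalEdges) ↔ edgeExp a b = some (1, 0)) ∧
      ((t = true ∧ s(a, b) = s(sq0, s0)) ∨ (u = true ∧ s(a, b) = s(n1, nq1)) ↔
        edgeExp a b = some (0, 1)) ∧
      (((o = true ∧ s(a, b) ∈ axisEdges) ∨ (r = true ∧ s(a, b) = s(w0, w1)) ∨
        (r' = true ∧ s(a, b) = s(e0, e1)) ∨ (t = true ∧ s(a, b) ∈ southEdges) ∨
        (u = true ∧ s(a, b) ∈ northEdges)) ↔
        edgeExp a b = some (0, 1) ∨ edgeExp a b = some (0, 0)) := by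
  intro o r r' t u
  cases o <;> cases r <;> cases r' <;> cases t <;> cases u <;> decide +kernel

end Corner

/-! ### Drawing a row of octagons in the plane -/

section Place

variable (b : ℤ → Bool)

/-- The position of a vertex in the plane; the octagons `k` with `b k` are reflected vertically. -/
def place (p : ℤ × Corner) : Pt :=
  (4 * p.1 + xOffset p.2, if b p.1 then 3 - yOffset p.2 else yOffset p.2)

theorem place_injective : Function.Injective (place b) := by
  rintro ⟨k, c⟩ ⟨l, d⟩ h
  obtain ⟨h1, h2⟩ := Prod.mk.inj h
  dsimp only at h1 h2
  have hc := xOffset_bounds c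
  have hd := xOffset_bounds d
  obtain rfl : k = l := by omega
  obtain rfl : c = d := by
    refine offset_injective c d (by omega) ?_
    split_ifs at h2 <;> omega
  rfl

/-- The edges `T` at the octagon `k`. -/
def edgesAt (k : ℤ) (T : Finset (Sym2 Corner)) : Finset (Sym2 (ℤ × Corner)) :=
  T.image (Sym2.map (Prod.mk k))

/-- The edges of the square between the octagons `k - 1` and `k`. -/
def rowSquareEdges (k : ℤ) : Finset (Sym2 (ℤ × Corner)) :=
  {s((k - 1, e0), (k, w1)), s((k - 1, e1), (k, w0)), s((k - 1, e0), (k - 1, e1)),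
    s((k, w0), (k, w1))}

theorem image_place_edgesAt (k : ℤ) (T : Finset (Sym2 Corner)) :
    (edgesAt k T).image (Sym2.map (place b)) = T.image (Sym2.map fun c => place b (k, c)) := by
  rw [edgesAt, image_image]
  congr 1
  rw [← Sym2.map_comp]
  rfl

theorem octagonDiagonals_octAt (k : ℤ) :
    octagonDiagonals (octAt k) = (edgesAt k diagonalEdges).image (Sym2.map (place b)) := by
  rw [image_place_edgesAt]
  simp only [octagonDiagonals, octAt, diagonalEdges, image_insert, image_singleton, Sym2.map_mk,
    place, xOffset, yOffset]
  cases b k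
  · norm_num
  · norm_num
    ext e
    simp only [mem_insert, mem_singleton, Sym2.eq_swap (a := (4 * k, (1 : ℤ))),
      Sym2.eq_swap (a := (4 * k + 3, (1 : ℤ))), Sym2.eq_swap (a := (4 * k + 1, (3 : ℤ))),
      Sym2.eq_swap (a := (4 * k + 3, (2 : ℤ)))]
    tauto

theorem octagonAxisEdges_octAt (k : ℤ) :
    octagonAxisEdges (octAt k) = (edgesAt k axisEdges).image (Sym2.map (place b)) := by
  rw [image_place_edgesAt]
  simp only [octagonAxisEdges, octAt, axisEdges, image_insert, image_singleton, Sym2.map_mk,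
    place, xOffset, yOffset]
  cases b k
  · norm_num
  · norm_num
    ext e
    simp only [mem_insert, mem_singleton, Sym2.eq_swap (a := (4 * k, (1 : ℤ))),
      Sym2.eq_swap (a := (4 * k + 3, (1 : ℤ)))]
    tauto

theorem squareEdges_south (k : ℤ) :
    squareEdges (sideSquare (b k) k) = (edgesAt k southEdges).image (Sym2.map (place b)) := by
  rw [image_place_edgesAt]
  simp only [squareEdges, sideSquare, southEdges, image_insert, image_singleton, Sym2.map_mk,
    place, xOffset, yOffset]
  cases b k
  · norm_num [add_assoc]
  · norm_num [add_assoc]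
    ext e
    simp only [mem_insert, mem_singleton,
      Sym2.eq_swap (a := (4 * k + 1, (4 : ℤ))) (b := (4 * k + 1, 3)),
      Sym2.eq_swap (a := (4 * k + 2, (4 : ℤ))) (b := (4 * k + 2, 3))]
    tauto

theorem squareEdges_north (k : ℤ) :
    squareEdges (sideSquare (!b k) k) = (edgesAt k northEdges).image (Sym2.map (place b)) := by
  rw [image_place_edgesAt]
  simp only [squareEdges, sideSquare, northEdges, image_insert, image_singleton, Sym2.map_mk,
    place, xOffset, yOffset]
  cases b k
  · norm_num [add_assoc]
  · norm_num [add_assoc]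
    ext e
    simp only [mem_insert, mem_singleton,
      Sym2.eq_swap (a := (4 * k + 1, (0 : ℤ))) (b := (4 * k + 1, -1)),
      Sym2.eq_swap (a := (4 * k + 2, (0 : ℤ))) (b := (4 * k + 2, -1))]
    tauto

theorem squareEdges_rowSquare {k : ℤ} (hb : b (k - 1) = !b k) :
    squareEdges (rowSquare k) = (rowSquareEdges k).image (Sym2.map (place b)) := by
  have hk : 4 * (k - 1) + 3 = 4 * k - 1 := by ring
  simp only [squareEdges, rowSquare, rowSquareEdges, image_insert, image_singleton, Sym2.map_mk,
    place, xOffset, yOffset, hb, hk]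
  cases b k
  · norm_num
    ext e
    simp only [mem_insert, mem_singleton,
      Sym2.eq_swap (a := (4 * k - 1, (2 : ℤ))) (b := (4 * k - 1, 1))]
    tauto
  · norm_num
    rw [Sym2.eq_swap (a := (4 * k, (1 : ℤ))) (b := (4 * k, 2))]

theorem sideLeftEdge_eq (k : ℤ) :
    sideLeftEdge (b k) k = Sym2.map (place b) s((k, sq0), (k, s0)) := by
  simp only [sideLeftEdge, Sym2.map_mk, place, xOffset, yOffset]
  cases b k
  · norm_num
  · norm_num

theorem sideRightEdge_eq (k : ℤ) :
    sideRightEdge (!b k) k = Sym2.map (place b) s((k, n1), (k, nq1)) := by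
  simp only [sideRightEdge, Sym2.map_mk, place, xOffset, yOffset]
  cases b k
  · norm_num
  · norm_num

theorem rowEdge_eq {k : ℤ} (hb : b (k - 1) = !b k) :
    rowEdge (!b k) k = Sym2.map (place b) s((k - 1, e0), (k, w1)) := by
  have hk : 4 * (k - 1) + 3 = 4 * k - 1 := by ring
  simp only [rowEdge, Sym2.map_mk, place, xOffset, yOffset, hb, hk]
  cases b k
  · norm_num
  · norm_num

theorem rightCorner_eq (k : ℤ) : rightCorner (b k) k = place b (k, s1) := by
  simp only [rightCorner, place, xOffset, yOffset]
  cases b k <;> norm_num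

theorem leftCorner_eq (k : ℤ) : leftCorner (!b k) k = place b (k, n0) := by
  simp only [leftCorner, place, xOffset, yOffset]
  cases b k <;> norm_num

end Place

/-- Which parts of the infinite row of octagons make up a graph: the octagons, the squares at the
south and north of an octagon, the squares `k` between the octagons `k - 1` and `k`, and the arcs
between the octagons `k - 1` and `k` that belong to southern or to northern squares. -/
structure Layout where
  octs : Finset ℤ
  souths : Finset ℤ
  norths : Finset ℤ
  rows : Finset ℤ
  southArcs : Finset ℤ
  northArcs : Finset ℤ

namespace Layout

variable (D : Layout) (b : ℤ → Bool)

/-- The graph drawn in the plane, with the octagons `k` with `b k` reflected vertically. -/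
def toCellGraph : CellGraph where
  octagons := D.octs.image octAt
  squares := D.rows.image rowSquare ∪ D.souths.image (fun k => sideSquare (b k) k) ∪
    D.norths.image (fun k => sideSquare (!b k) k)
  arcs := D.southArcs.image (fun k => s(rightCorner (b k) k, rightCorner (b (k - 1)) (k - 1))) ∪
    D.northArcs.image (fun k => s(leftCorner (!b k) k, leftCorner (!b (k - 1)) (k - 1)))
  x2Edges := D.rows.image (fun k => rowEdge (!b k) k) ∪
    D.souths.image (fun k => sideLeftEdge (b k) k) ∪
    D.norths.image (fun k => sideRightEdge (!b k) k)

/-- The diagonal edges. -/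
def diagonals : Finset (Sym2 (ℤ × Corner)) := D.octs.biUnion fun k => edgesAt k diagonalEdges

/-- All edges but the diagonal ones. -/
def otherEdges : Finset (Sym2 (ℤ × Corner)) :=
  (D.octs.biUnion fun k => edgesAt k axisEdges) ∪
    (D.rows.biUnion rowSquareEdges ∪ (D.souths.biUnion fun k => edgesAt k southEdges) ∪
      D.norths.biUnion fun k => edgesAt k northEdges) ∪
    (D.southArcs.image (fun k => s((k - 1, s1), (k, s1))) ∪
      D.northArcs.image fun k => s((k - 1, n0), (k, n0)))

/-- The edges of weight `x₂`. -/
def heavyEdges : Finset (Sym2 (ℤ × Corner)) :=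
  D.rows.image (fun k => s((k - 1, e0), (k, w1))) ∪
    D.souths.image (fun k => s((k, sq0), (k, s0))) ∪
    D.norths.image fun k => s((k, n1), (k, nq1))

variable {b}

theorem diagonals_toCellGraph :
    (D.toCellGraph b).diagonals = D.diagonals.image (Sym2.map (place b)) := by
  simp only [CellGraph.diagonals, toCellGraph, diagonals, biUnion_image, image_biUnion,
    ← octagonDiagonals_octAt]

theorem edges_toCellGraph (hb : ∀ k, b (k - 1) = !b k) :
    (D.toCellGraph b).edges = (D.diagonals ∪ D.otherEdges).image (Sym2.map (place b)) := by
  have hrow : ∀ k, (rowSquareEdges k).image (Sym2.map (place b)) = squareEdges (rowSquare k) :=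
    fun k => (squareEdges_rowSquare b (hb k)).symm
  have hswap : ∀ k c, s(place b (k, c), place b (k - 1, c)) =
      Sym2.map (place b) s((k - 1, c), (k, c)) := fun k c => Sym2.eq_swap
  have hL : ∀ k, leftCorner (!b k) k = place b (k, n0) := leftCorner_eq b
  rw [CellGraph.edges, diagonals_toCellGraph]
  simp only [toCellGraph, otherEdges, image_union, biUnion_image, image_biUnion, union_biUnion,
    ← octagonAxisEdges_octAt, ← squareEdges_south, ← squareEdges_north, hrow, rightCorner_eq,
    hL, hswap, image_image, union_assoc]
  rfl

theorem x2Edges_toCellGraph (hb : ∀ k, b (k - 1) = !b k) :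
    (D.toCellGraph b).x2Edges = D.heavyEdges.image (Sym2.map (place b)) := by
  simp only [toCellGraph, heavyEdges, image_union, image_image, sideLeftEdge_eq, sideRightEdge_eq,
    rowEdge_eq b (hb _)]
  rfl

/-- The vertices at the octagon `k`. -/
def corners (k : ℤ) : Finset Corner :=
  univ.filter fun c => present (k ∈ D.octs) (k ∈ D.rows) (k + 1 ∈ D.rows) (k ∈ D.souths)
    (k ∈ D.norths) c

theorem mem_corners {k : ℤ} {c : Corner} : c ∈ D.corners k ↔
    present (k ∈ D.octs) (k ∈ D.rows) (k + 1 ∈ D.rows) (k ∈ D.souths) (k ∈ D.norths) c := by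
  simp [corners]

end Layout

/-! ### The graphs in the plane as parts of the infinite row -/

theorem mk_mem_edgesAt {j k l : ℤ} {a c : Corner} {T : Finset (Sym2 Corner)} :
    s((k, a), (l, c)) ∈ edgesAt j T ↔ k = j ∧ l = j ∧ s(a, c) ∈ T := by
  simp only [edgesAt, mem_image]
  constructor
  · rintro ⟨e, he, h⟩
    induction e with
    | _ x y =>
      rw [Sym2.map_mk, Sym2.eq_iff] at h
      simp only [Prod.mk.injEq] at h
      rcases h with ⟨⟨rfl, rfl⟩, ⟨rfl, rfl⟩⟩ | ⟨⟨rfl, rfl⟩, ⟨rfl, rfl⟩⟩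
      · exact ⟨rfl, rfl, he⟩
      · exact ⟨rfl, rfl, by rwa [Sym2.eq_swap]⟩
  · rintro ⟨rfl, rfl, h⟩
    exact ⟨_, h, rfl⟩

theorem mk_same_eq_same {j k : ℤ} {a c x z : Corner} :
    s((k, a), (k, c)) = s((j, x), (j, z)) ↔ j = k ∧ s(a, c) = s(x, z) := by
  have := mk_mem_edgesAt (j := j) (k := k) (l := k) (a := a) (c := c) (T := {s(x, z)})
  rw [edgesAt, image_singleton, mem_singleton, mem_singleton, Sym2.map_mk] at this
  rw [this]
  exact ⟨fun h => ⟨h.1.symm, h.2.2⟩, fun h => ⟨h.1.symm, h.1.symm, h.2⟩⟩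

theorem mk_same_ne_succ {j k : ℤ} {a c x z : Corner} :
    s((k, a), (k, c)) ≠ s((j - 1, x), (j, z)) := by
  rw [Ne, Sym2.eq_iff, Prod.mk.injEq, Prod.mk.injEq, Prod.mk.injEq, Prod.mk.injEq]
  rintro (⟨⟨h, -⟩, h', -⟩ | ⟨⟨h, -⟩, h', -⟩) <;> omega

theorem mk_succ_eq_succ {j k : ℤ} {a c x z : Corner} :
    s((k - 1, a), (k, c)) = s((j - 1, x), (j, z)) ↔ j = k ∧ a = x ∧ c = z := by
  rw [Sym2.eq_iff, Prod.mk.injEq, Prod.mk.injEq, Prod.mk.injEq, Prod.mk.injEq]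
  constructor
  · rintro (⟨⟨-, rfl⟩, rfl, rfl⟩ | ⟨⟨h, -⟩, h', -⟩)
    · exact ⟨rfl, rfl, rfl⟩
    · omega
  · rintro ⟨rfl, rfl, rfl⟩
    exact Or.inl ⟨⟨rfl, rfl⟩, rfl, rfl⟩

theorem mk_far_ne_same {j k l : ℤ} (h : k < l) {a c x z : Corner} :
    s((k, a), (l, c)) ≠ s((j, x), (j, z)) := by
  rw [Ne, Sym2.eq_iff, Prod.mk.injEq, Prod.mk.injEq, Prod.mk.injEq, Prod.mk.injEq]
  rintro (⟨⟨h, -⟩, h', -⟩ | ⟨⟨h, -⟩, h', -⟩) <;> omega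

theorem mk_far_ne_succ {j k l : ℤ} (h : k + 1 < l) {a c x z : Corner} :
    s((k, a), (l, c)) ≠ s((j - 1, x), (j, z)) := by
  rw [Ne, Sym2.eq_iff, Prod.mk.injEq, Prod.mk.injEq, Prod.mk.injEq, Prod.mk.injEq]
  rintro (⟨⟨h, -⟩, h', -⟩ | ⟨⟨h, -⟩, h', -⟩) <;> omega

namespace Layout

variable (D : Layout)

theorem same_mem_diagonals {k : ℤ} {a c : Corner} :
    s((k, a), (k, c)) ∈ D.diagonals ↔ k ∈ D.octs ∧ s(a, c) ∈ diagonalEdges := by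
  simp only [diagonals, mem_biUnion, mk_mem_edgesAt]
  constructor
  · rintro ⟨_, h, rfl, -, h'⟩
    exact ⟨h, h'⟩
  · rintro ⟨h, h'⟩
    exact ⟨k, h, rfl, rfl, h'⟩

theorem notMem_diagonals {k l : ℤ} (hkl : k ≠ l) {a c : Corner} :
    s((k, a), (l, c)) ∉ D.diagonals := by
  simp only [diagonals, mem_biUnion, mk_mem_edgesAt]
  rintro ⟨_, -, rfl, rfl, -⟩
  exact hkl rfl

theorem same_mem_heavyEdges {k : ℤ} {a c : Corner} :
    s((k, a), (k, c)) ∈ D.heavyEdges ↔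
      (k ∈ D.souths ∧ s(a, c) = s(sq0, s0)) ∨ (k ∈ D.norths ∧ s(a, c) = s(n1, nq1)) := by
  simp only [heavyEdges, mem_union, mem_image, eq_comm (b := s((k, a), (k, c))), mk_same_eq_same,
    mk_same_ne_succ, and_false, exists_false, false_or]
  refine or_congr ?_ ?_ <;>
    exact ⟨fun ⟨j, hj, h, h'⟩ => ⟨h ▸ hj, h'⟩, fun ⟨h, h'⟩ => ⟨k, h, rfl, h'⟩⟩

theorem same_mem_otherEdges {k : ℤ} {a c : Corner} :
    s((k, a), (k, c)) ∈ D.otherEdges ↔ (k ∈ D.octs ∧ s(a, c) ∈ axisEdges) ∨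
      (k ∈ D.rows ∧ s(a, c) = s(w0, w1)) ∨ (k + 1 ∈ D.rows ∧ s(a, c) = s(e0, e1)) ∨
      (k ∈ D.souths ∧ s(a, c) ∈ southEdges) ∨ (k ∈ D.norths ∧ s(a, c) ∈ northEdges) := by
  simp only [otherEdges, mem_union, mem_biUnion, mem_image, mk_mem_edgesAt, rowSquareEdges,
    mem_insert, mem_singleton, eq_comm (b := s((k, a), (k, c))), mk_same_eq_same, mk_same_ne_succ,
    and_false, exists_false, false_or, or_false]
  constructor
  · rintro (⟨_, h, rfl, -, h'⟩ | (⟨j, h, ⟨rfl, h'⟩ | ⟨rfl, h'⟩⟩ | ⟨_, h, rfl, -, h'⟩) |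
      ⟨_, h, rfl, -, h'⟩)
    · exact Or.inl ⟨h, h'⟩
    · rw [sub_add_cancel]
      exact Or.inr (Or.inr (Or.inl ⟨h, h'⟩))
    · exact Or.inr (Or.inl ⟨h, h'⟩)
    · exact Or.inr (Or.inr (Or.inr (Or.inl ⟨h, h'⟩)))
    · exact Or.inr (Or.inr (Or.inr (Or.inr ⟨h, h'⟩)))
  · rintro (⟨h, h'⟩ | ⟨h, h'⟩ | ⟨h, h'⟩ | ⟨h, h'⟩ | ⟨h, h'⟩)
    · exact Or.inl ⟨k, h, rfl, rfl, h'⟩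
    · exact Or.inr (Or.inl (Or.inl ⟨k, h, Or.inr ⟨rfl, h'⟩⟩))
    · exact Or.inr (Or.inl (Or.inl ⟨k + 1, h, Or.inl ⟨add_sub_cancel_right k 1, h'⟩⟩))
    · exact Or.inr (Or.inl (Or.inr ⟨k, h, rfl, rfl, h'⟩))
    · exact Or.inr (Or.inr ⟨k, h, rfl, rfl, h'⟩)

theorem succ_mem_heavyEdges {k : ℤ} {a c : Corner} :
    s((k - 1, a), (k, c)) ∈ D.heavyEdges ↔ k ∈ D.rows ∧ a = e0 ∧ c = w1 := by
  simp only [heavyEdges, mem_union, mem_image, eq_comm (b := s((k - 1, a), (k, c))),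
    mk_succ_eq_succ, mk_far_ne_same (sub_one_lt k), and_false, exists_false, or_false]
  exact ⟨fun ⟨j, hj, h, h'⟩ => ⟨h ▸ hj, h'⟩, fun ⟨h, h'⟩ => ⟨k, h, rfl, h'⟩⟩

theorem succ_mem_otherEdges {k : ℤ} {a c : Corner} :
    s((k - 1, a), (k, c)) ∈ D.otherEdges ↔
      (k ∈ D.rows ∧ ((a = e0 ∧ c = w1) ∨ (a = e1 ∧ c = w0))) ∨
      (k ∈ D.southArcs ∧ a = s1 ∧ c = s1) ∨ (k ∈ D.northArcs ∧ a = n0 ∧ c = n0) := by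
  have hne : ∀ j, ¬ (k - 1 = j ∧ k = j) := fun j => by omega
  simp only [otherEdges, mem_union, mem_biUnion, mem_image, mk_mem_edgesAt, rowSquareEdges,
    mem_insert, mem_singleton, eq_comm (b := s((k - 1, a), (k, c))), mk_succ_eq_succ,
    mk_far_ne_same (sub_one_lt k), ← and_assoc, hne, false_and, and_false, exists_false, or_false,
    false_or]
  constructor
  · rintro (⟨j, hj, ⟨⟨rfl, h⟩, h'⟩ | ⟨⟨rfl, h⟩, h'⟩⟩ | ⟨j, ⟨⟨hj, rfl⟩, h⟩, h'⟩ |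
      ⟨j, ⟨⟨hj, rfl⟩, h⟩, h'⟩)
    · exact Or.inl ⟨hj, Or.inl ⟨h, h'⟩⟩
    · exact Or.inl ⟨hj, Or.inr ⟨h, h'⟩⟩
    · exact Or.inr (Or.inl ⟨⟨hj, h⟩, h'⟩)
    · exact Or.inr (Or.inr ⟨⟨hj, h⟩, h'⟩)
  · rintro (⟨h, h' | h'⟩ | ⟨⟨h, h'⟩, h''⟩ | ⟨⟨h, h'⟩, h''⟩)
    · exact Or.inl ⟨k, h, Or.inl ⟨⟨rfl, h'.1⟩, h'.2⟩⟩
    · exact Or.inl ⟨k, h, Or.inr ⟨⟨rfl, h'.1⟩, h'.2⟩⟩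
    · exact Or.inr (Or.inl ⟨k, ⟨⟨h, rfl⟩, h'⟩, h''⟩)
    · exact Or.inr (Or.inr ⟨k, ⟨⟨h, rfl⟩, h'⟩, h''⟩)

theorem far_notMem_otherEdges {k l : ℤ} (h : k + 1 < l) {a c : Corner} :
    s((k, a), (l, c)) ∉ D.otherEdges := by
  have hne : ∀ j, ¬ (k = j ∧ l = j) := fun j => by omega
  simp only [otherEdges, mem_union, mem_biUnion, mem_image, mk_mem_edgesAt, rowSquareEdges,
    mem_insert, mem_singleton, eq_comm (b := s((k, a), (l, c))), mk_far_ne_succ h,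
    mk_far_ne_same (show k < l by omega), ← and_assoc, hne, false_and, and_false, exists_false,
    or_false, not_false_eq_true]

/-- The parts fit together: northern and southern squares are attached to octagons, there is a
square between any two consecutive octagons, and the arc between them joins the vertices
`arc k`. -/
structure IsValid (arc : ℤ → Corner) : Prop where
  souths_subset : ∀ k ∈ D.souths, k ∈ D.octs
  norths_subset : ∀ k ∈ D.norths, k ∈ D.octs
  mem_rows : ∀ k, k - 1 ∈ D.octs → k ∈ D.octs → k ∈ D.rows
  mem_southArcs : ∀ k, k ∈ D.southArcs ↔ k - 1 ∈ D.octs ∧ k ∈ D.octs ∧ arc k = s1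
  mem_northArcs : ∀ k, k ∈ D.northArcs ↔ k - 1 ∈ D.octs ∧ k ∈ D.octs ∧ arc k = n0
  arc_eq : ∀ k, arc k = s1 ∨ arc k = n0

variable {R : Type*} [CommRing R] (s y : R)

/-- The weights of the edges, extended by `0` to all pairs of vertices. -/
def weight (e : Sym2 (ℤ × Corner)) : R :=
  if e ∈ D.diagonals ∪ D.otherEdges then
    if e ∈ D.diagonals then s else if e ∈ D.heavyEdges then y else 1
  else 0

variable {D} {arc : ℤ → Corner}

theorem weight_same (hD : D.IsValid arc) {k : ℤ} {a c : Corner} (ha : a ∈ D.corners k)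
    (hc : c ∈ D.corners k) : D.weight s y s((k, a), (k, c)) = edgeValue s y (edgeExp a c) := by
  rw [mem_corners] at ha hc
  obtain ⟨h1, h2, h3⟩ := mem_edges_iff_of_present _ _ _ _ _
    (by simpa using hD.souths_subset k) (by simpa using hD.norths_subset k) a c ha hc
  simp only [decide_eq_true_eq] at h1 h2 h3
  rw [← same_mem_diagonals] at h1
  rw [← same_mem_heavyEdges] at h2
  rw [← same_mem_otherEdges] at h3
  simp only [weight, mem_union, h1, h2, h3]
  rcases h : edgeExp a c with _ | e
  · simp [edgeValue]
  · have : ∀ a c e, edgeExp a c = some e → e = (0, 0) ∨ e = (1, 0) ∨ e = (0, 1) := by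
      intro a c e
      cases a <;> cases c <;> simp only [edgeExp, Option.some.injEq, reduceCtorEq,
        false_implies] <;> rintro rfl <;> simp
    rcases this a c e h with rfl | rfl | rfl <;> simp [edgeValue, bimonomial]

theorem weight_succ (hD : D.IsValid arc) {k : ℤ} {a c : Corner} (ha : a ∈ D.corners (k - 1))
    (hc : c ∈ D.corners k) : D.weight s y s((k - 1, a), (k, c)) = crossWeight y (arc k) a c := by
  rw [mem_corners, sub_add_cancel] at ha
  rw [mem_corners] at hc
  have hdiag := D.notMem_diagonals (show k - 1 ≠ k by omega) (a := a) (c := c)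
  simp only [weight, mem_union, hdiag, false_or, if_false, succ_mem_otherEdges,
    succ_mem_heavyEdges, hD.mem_southArcs, hD.mem_northArcs]
  have hrow := hD.mem_rows k
  have harc := hD.arc_eq k
  by_cases h1 : a = e0 ∧ c = w1
  · obtain ⟨rfl, rfl⟩ := h1
    have : k ∈ D.rows := by
      simp [present] at ha hc
      tauto
    simp [crossWeight, this]
  by_cases h2 : a = e1 ∧ c = w0
  · obtain ⟨rfl, rfl⟩ := h2
    have : k ∈ D.rows := by
      simp [present] at ha hc
      tauto
    simp [crossWeight, this]
  simp only [h1, h2, or_self, and_false, false_or, if_false, crossWeight]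
  congr 1
  rw [eq_iff_iff]
  constructor
  · rintro (⟨⟨-, -, h⟩, rfl, rfl⟩ | ⟨⟨-, -, h⟩, rfl, rfl⟩) <;> exact ⟨h.symm, h.symm⟩
  · rintro ⟨rfl, rfl⟩
    rcases harc with h | h <;> rw [h] at ha hc ⊢ <;> simp [present] at ha hc <;> simp [ha, hc]

/-- On the vertices that are present, the graph is an induced subgraph of the infinite row. -/
theorem weight_eq_chainWeight (hD : D.IsValid arc) {p q : ℤ × Corner} (hp : p.2 ∈ D.corners p.1)
    (hq : q.2 ∈ D.corners q.1) : D.weight s y s(p, q) = chainWeight s y arc s(p, q) := by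
  wlog hpq : p.1 ≤ q.1 generalizing p q
  · rw [Sym2.eq_swap]
    exact this hq hp (by omega)
  obtain ⟨k, a⟩ := p
  obtain ⟨l, c⟩ := q
  dsimp only at hp hq hpq
  rcases (show k = l ∨ k = l - 1 ∨ k + 1 < l by omega) with rfl | rfl | h
  · rw [weight_same s y hD hp hq, chainWeight_same, blockWeight_mk]
  · rw [weight_succ s y hD hp hq, chainWeight_succ]
  · rw [chainWeight_far s y arc h, weight, if_neg]
    rw [mem_union, not_or]
    exact ⟨D.notMem_diagonals (by omega), D.far_notMem_otherEdges h⟩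

theorem mem_of_mem_edgesAt {T : Finset (Sym2 Corner)} {k : ℤ} {e : Sym2 (ℤ × Corner)}
    (he : e ∈ edgesAt k T) {p : ℤ × Corner} (hp : p ∈ e) : p.1 = k ∧ ∃ e' ∈ T, p.2 ∈ e' := by
  obtain ⟨e', he', rfl⟩ := mem_image.1 he
  obtain ⟨c, hc, rfl⟩ := Sym2.mem_map.1 hp
  exact ⟨rfl, e', he', hc⟩

theorem mem_corners_of_mem_edge (hD : D.IsValid arc) {e : Sym2 (ℤ × Corner)}
    (he : e ∈ D.diagonals ∪ D.otherEdges) {p : ℤ × Corner} (hp : p ∈ e) :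
    p.2 ∈ D.corners p.1 := by
  obtain ⟨k, c⟩ := p
  have hoct : ∀ c, (∃ e' ∈ diagonalEdges ∪ axisEdges, c ∈ e') →
      ∀ r r' t u, present true r r' t u c := by decide
  have hsouth : ∀ c, (∃ e' ∈ southEdges, c ∈ e') → ∀ r r' u, present true r r' true u c := by
    decide
  have hnorth : ∀ c, (∃ e' ∈ northEdges, c ∈ e') → ∀ r r' t, present true r r' t true c := by
    decide
  dsimp only
  rw [mem_corners]
  simp only [diagonals, otherEdges, mem_union, mem_biUnion, mem_image] at he
  rcases he with ⟨j, hj, he⟩ | (⟨j, hj, he⟩ | (⟨j, hj, he⟩ | ⟨j, hj, he⟩) | ⟨j, hj, he⟩) |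
    ⟨j, hj, he⟩ | ⟨j, hj, he⟩
  · obtain ⟨rfl, e', he', hc⟩ := mem_of_mem_edgesAt he hp
    simpa [hj] using hoct c ⟨e', mem_union_left _ he', hc⟩ _ _ _ _
  · obtain ⟨rfl, e', he', hc⟩ := mem_of_mem_edgesAt he hp
    simpa [hj] using hoct c ⟨e', mem_union_right _ he', hc⟩ _ _ _ _
  · simp only [rowSquareEdges, mem_insert, mem_singleton] at he
    rcases he with rfl | rfl | rfl | rfl <;> simp only [Sym2.mem_iff, Prod.mk.injEq] at hp <;>
      rcases hp with ⟨rfl, rfl⟩ | ⟨rfl, rfl⟩ <;> simp [present, hj]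
  · obtain ⟨rfl, e', he', hc⟩ := mem_of_mem_edgesAt he hp
    simpa [hj, hD.souths_subset _ hj] using hsouth c ⟨e', he', hc⟩ _ _ _
  · obtain ⟨rfl, e', he', hc⟩ := mem_of_mem_edgesAt he hp
    simpa [hj, hD.norths_subset _ hj] using hnorth c ⟨e', he', hc⟩ _ _ _
  · rw [hD.mem_southArcs] at hj
    subst he
    simp only [Sym2.mem_iff, Prod.mk.injEq] at hp
    rcases hp with ⟨rfl, rfl⟩ | ⟨rfl, rfl⟩ <;> simp [present, hj]
  · rw [hD.mem_northArcs] at hj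
    subst he
    simp only [Sym2.mem_iff, Prod.mk.injEq] at hp
    rcases hp with ⟨rfl, rfl⟩ | ⟨rfl, rfl⟩ <;> simp [present, hj]

/-- Every vertex that is present at an octagon is the end of an edge there. -/
theorem exists_edge_of_mem_corners {p : ℤ × Corner}
    (hp : p.2 ∈ D.corners p.1) : ∃ e ∈ D.diagonals ∪ D.otherEdges, p ∈ e := by
  obtain ⟨k, c⟩ := p
  have key : ∀ d, s(c, d) ∈ axisEdges ∧ k ∈ D.octs ∨ k ∈ D.rows ∧ s(c, d) = s(w0, w1) ∨
      k + 1 ∈ D.rows ∧ s(c, d) = s(e0, e1) ∨ k ∈ D.souths ∧ s(c, d) ∈ southEdges ∨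
      k ∈ D.norths ∧ s(c, d) ∈ northEdges → ∃ e ∈ D.diagonals ∪ D.otherEdges, (k, c) ∈ e := by
    intro d h
    refine ⟨s((k, c), (k, d)), mem_union_right _ (D.same_mem_otherEdges.2 ?_),
      Sym2.mem_mk_left _ _⟩
    tauto
  rw [mem_corners] at hp
  cases c <;> simp only [present, Bool.or_eq_true, decide_eq_true_eq] at hp
  · refine key w1 ?_
    simpa [axisEdges] using by tauto
  · refine key w0 ?_
    simpa [axisEdges] using by tauto
  · refine key e1 ?_
    simpa [axisEdges] using by tauto
  · refine key e0 ?_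
    simpa [axisEdges] using by tauto
  · exact key s1 (Or.inl ⟨by decide, hp⟩)
  · exact key s0 (Or.inl ⟨by decide, hp⟩)
  · exact key n1 (Or.inl ⟨by decide, hp⟩)
  · exact key n0 (Or.inl ⟨by decide, hp⟩)
  · exact key sq1 (Or.inr (Or.inr (Or.inr (Or.inl ⟨hp, by decide⟩))))
  · exact key sq0 (Or.inr (Or.inr (Or.inr (Or.inl ⟨hp, by decide⟩))))
  · exact key nq1 (Or.inr (Or.inr (Or.inr (Or.inr ⟨hp, by decide⟩))))
  · exact key nq0 (Or.inr (Or.inr (Or.inr (Or.inr ⟨hp, by decide⟩))))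

/-- There are no loops, as the table `edgeExp` has none. -/
theorem not_isDiag_of_mem_edge (hD : D.IsValid arc) {e : Sym2 (ℤ × Corner)}
    (he : e ∈ D.diagonals ∪ D.otherEdges) : ¬ e.IsDiag := by
  induction e with
  | _ p q =>
    intro h
    obtain rfl : p = q := by simpa using h
    have hp := mem_corners_of_mem_edge hD he (Sym2.mem_mk_left p p)
    have hself : ∀ c, edgeExp c c = none := by decide
    have h1 := weight_same (1 : ℤ) 1 hD hp hp
    rw [hself, weight, if_pos he] at h1
    simp [edgeValue] at h1

/-- The matching sum of the graph in the plane is a Hafnian of the weights of the infinite row. -/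
theorem matchingSum_toCellGraph (hD : D.IsValid arc) {b : ℤ → Bool}
    (hb : ∀ k, b (k - 1) = !b k) {a : ℤ} {n : ℕ}
    (hn : ∀ k, (D.corners k).Nonempty → a ≤ k ∧ k < a + n) :
    (D.toCellGraph b).toWeightedGraph.matchingSum =
      hafnian (chainWeight (MvPolynomial.X 0) (MvPolynomial.X 1) arc) (row D.corners a n) := by
  have hinj := place_injective b
  have hmap := Sym2.map.injective hinj
  have hedges := D.edges_toCellGraph hb
  have hverts : (D.toCellGraph b).edges.biUnion Sym2.toFinset =
      (row D.corners a n).image (place b) := by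
    rw [hedges]
    ext v
    simp only [mem_biUnion, mem_image, exists_exists_and_eq_and, Sym2.mem_toFinset, Sym2.mem_map,
      mem_row]
    constructor
    · rintro ⟨e, he, p, hp, rfl⟩
      have := mem_corners_of_mem_edge hD he hp
      exact ⟨p, ⟨(hn _ ⟨_, this⟩).1, (hn _ ⟨_, this⟩).2, this⟩, rfl⟩
    · rintro ⟨p, ⟨-, -, hp⟩, rfl⟩
      obtain ⟨e, he, hpe⟩ := exists_edge_of_mem_corners hp
      exact ⟨e, he, p, hpe, rfl⟩
  rw [matchingSum_eq_hafnian _ ?_ rfl]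
  · change hafnian _ ((D.toCellGraph b).edges.biUnion Sym2.toFinset) = _
    rw [hverts, hafnian_image _ hinj]
    refine hafnian_congr fun p hp q hq _ => ?_
    rw [← weight_eq_chainWeight _ _ hD ((mem_row _ _ _ _).1 hp).2.2 ((mem_row _ _ _ _).1 hq).2.2]
    simp only [CellGraph.toWeightedGraph, hedges, diagonals_toCellGraph, x2Edges_toCellGraph D hb,
      hmap.mem_finset_image, weight]
  · intro e he
    change e ∈ (D.toCellGraph b).edges at he
    rw [hedges] at he
    obtain ⟨e', he', rfl⟩ := mem_image.1 he
    rw [Sym2.isDiag_map hinj]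
    exact not_isDiag_of_mem_edge hD he'

end Layout

/-! ### The matching sums of the four families -/

theorem isEven_eq_not_isOdd (k : ℤ) : isEven k = !isOdd k := by
  simp only [isEven, isOdd, ← Int.not_even_iff_odd, decide_not, Bool.not_not]

theorem isOdd_sub_one (k : ℤ) : isOdd (k - 1) = !isOdd k := by
  have : Odd (k - 1) ↔ ¬ Odd k := by rw [Int.odd_sub]; simp
  simp only [isOdd, this, decide_not]

theorem isEven_sub_one (k : ℤ) : isEven (k - 1) = !isEven k := by
  rw [isEven_eq_not_isOdd, isEven_eq_not_isOdd, isOdd_sub_one]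

namespace Layout

section Corners

variable {D : Layout} {arc : ℤ → Corner} {k : ℤ}

theorem corners_south (ho : k ∈ D.octs) (hs : k ∈ D.souths) (hn : k ∉ D.norths) :
    D.corners k = octagonCorners ∪ southCorners := by
  ext c
  rw [mem_corners]
  cases c <;> simp [present, octagonCorners, southCorners, ho, hs, hn]

theorem corners_north (ho : k ∈ D.octs) (hs : k ∉ D.souths) (hn : k ∈ D.norths) :
    D.corners k = octagonCorners ∪ northCorners := by
  ext c
  rw [mem_corners]
  cases c <;> simp [present, octagonCorners, northCorners, ho, hs, hn]

theorem corners_both (ho : k ∈ D.octs) (hs : k ∈ D.souths) (hn : k ∈ D.norths) :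
    D.corners k = octagonCorners ∪ southCorners ∪ northCorners := by
  ext c
  rw [mem_corners]
  cases c <;> simp [present, octagonCorners, southCorners, northCorners, ho, hs, hn]

theorem corners_bare (ho : k ∈ D.octs) (hs : k ∉ D.souths) (hn : k ∉ D.norths) :
    D.corners k = octagonCorners := by
  ext c
  rw [mem_corners]
  cases c <;> simp [present, octagonCorners, ho, hs, hn]

theorem corners_eastern (hD : D.IsValid arc) (ho : k ∉ D.octs) (hr : k ∉ D.rows)
    (hr' : k + 1 ∈ D.rows) : D.corners k = {e0, e1} := by
  have hs : k ∉ D.souths := fun h => ho (hD.souths_subset k h)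
  have hn : k ∉ D.norths := fun h => ho (hD.norths_subset k h)
  ext c
  rw [mem_corners]
  cases c <;> simp [present, ho, hr, hr', hs, hn]

theorem corners_western (hD : D.IsValid arc) (ho : k ∉ D.octs) (hr : k ∈ D.rows)
    (hr' : k + 1 ∉ D.rows) : D.corners k = {w0, w1} := by
  have hs : k ∉ D.souths := fun h => ho (hD.souths_subset k h)
  have hn : k ∉ D.norths := fun h => ho (hD.norths_subset k h)
  ext c
  rw [mem_corners]
  cases c <;> simp [present, ho, hr, hr', hs, hn]

theorem mem_of_corners_nonempty (hD : D.IsValid arc) (h : (D.corners k).Nonempty) :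
    k ∈ D.octs ∨ k ∈ D.rows ∨ k + 1 ∈ D.rows := by
  by_contra! hcon
  have hs : k ∉ D.souths := fun h => hcon.1 (hD.souths_subset k h)
  have hn : k ∉ D.norths := fun h => hcon.1 (hD.norths_subset k h)
  obtain ⟨c, hc⟩ := h
  rw [mem_corners] at hc
  cases c <;> simp [present, hcon, hs, hn] at hc

end Corners

/-- The layout of `graphA N`: southern squares once the odd octagons are reflected. -/
noncomputable def layoutA (N : ℕ) : Layout where
  octs := Icc (1 - N) 0
  souths := Icc (1 - N) 0
  norths := ∅
  rows := Icc (1 - N) 1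
  southArcs := Icc (2 - N) 0
  northArcs := ∅

/-- The layout of `graphD N`: northern squares once the odd octagons are reflected. -/
noncomputable def layoutD (N : ℕ) : Layout where
  octs := Icc (1 - N) 0
  souths := ∅
  norths := Icc (1 - N) 0
  rows := Icc (2 - N) 0
  southArcs := ∅
  northArcs := Icc (2 - N) 0

/-- The layout of `graphB N`: once the even octagons are reflected, southern squares on the left,
northern squares on the right and both in the centre. -/
noncomputable def layoutB (N : ℕ) : Layout where
  octs := Icc (-N) N
  souths := Icc (-N) 0
  norths := Icc 0 N
  rows := Icc (-N) (N + 1)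
  southArcs := Icc (1 - N) 0
  northArcs := Icc 1 N

/-- The layout of `graphC N`: once the odd octagons are reflected, northern squares on the left and
southern squares on the right. -/
noncomputable def layoutC (N : ℕ) : Layout where
  octs := Icc (-N) N
  souths := Icc 1 N
  norths := Icc (-N) (-1)
  rows := Icc (1 - N) N
  southArcs := Icc 1 N
  northArcs := Icc (1 - N) 0

theorem graphA_eq (N : ℕ) : graphA N = (layoutA N).toCellGraph isOdd := by
  simp [graphA, layoutA, toCellGraph, isEven_eq_not_isOdd]

theorem graphD_eq (N : ℕ) : graphD N = (layoutD N).toCellGraph isOdd := by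
  simp [graphD, layoutD, toCellGraph, isEven_eq_not_isOdd]

theorem graphB_eq (N : ℕ) : graphB N = (layoutB N).toCellGraph isEven := by
  simp [graphB, layoutB, toCellGraph, isEven_eq_not_isOdd]

theorem graphC_eq (N : ℕ) : graphC N = (layoutC N).toCellGraph isOdd := by
  simp only [graphC, layoutC, toCellGraph, isEven_eq_not_isOdd, CellGraph.mk.injEq]
  exact ⟨trivial, union_right_comm _ _ _, union_comm _ _, union_right_comm _ _ _⟩

theorem isValid_layoutA (N : ℕ) : (layoutA N).IsValid fun _ => s1 := by
  constructor <;> simp [layoutA] <;> intros <;> omega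

theorem isValid_layoutD (N : ℕ) : (layoutD N).IsValid fun _ => n0 := by
  constructor <;> simp [layoutD] <;> intros <;> omega

theorem isValid_layoutB (N : ℕ) :
    (layoutB N).IsValid fun k => if k ≤ 0 then s1 else n0 := by
  constructor <;> simp [layoutB] <;> intros <;> omega

theorem isValid_layoutC (N : ℕ) :
    (layoutC N).IsValid fun k => if k ≤ 0 then n0 else s1 := by
  constructor <;> simp [layoutC] <;> intros <;> omega

theorem card_octagons_toCellGraph (D : Layout) (b : ℤ → Bool) :
    (D.toCellGraph b).octagons.card = D.octs.card := by
  refine card_image_of_injective _ fun k l h => ?_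
  have := congrArg Prod.fst h
  simp only [octAt] at this
  omega

theorem card_squares_toCellGraph (D : Layout) (b : ℤ → Bool) :
    (D.toCellGraph b).squares.card = D.rows.card + D.souths.card + D.norths.card := by
  have hfst : ∀ t k, (sideSquare t k).1 = 4 * k + 1 := by
    intro t k
    cases t <;> rfl
  have hsnd : ∀ t k, (sideSquare t k).2 = if t then 3 else -1 := by
    intro t k
    cases t <;> rfl
  have hinj : ∀ f : ℤ → Bool, Function.Injective fun k => sideSquare (f k) k := by
    intro f k l h
    have := congrArg Prod.fst h
    simp only [hfst] at this
    omega
  have hrow : Function.Injective rowSquare := by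
    intro k l h
    have := congrArg Prod.fst h
    simp only [rowSquare] at this
    omega
  simp only [toCellGraph]
  rw [card_union_of_disjoint, card_union_of_disjoint, card_image_of_injective _ hrow,
    card_image_of_injective _ (hinj _), card_image_of_injective _ (hinj _)]
  · refine disjoint_left.2 fun p hp hp' => ?_
    obtain ⟨k, -, rfl⟩ := mem_image.1 hp
    obtain ⟨l, -, h⟩ := mem_image.1 hp'
    have := congrArg Prod.fst h
    simp only [rowSquare, hfst] at this
    omega
  · refine disjoint_left.2 fun p hp hp' => ?_
    obtain ⟨l, -, rfl⟩ := mem_image.1 hp'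
    rcases mem_union.1 hp with hp | hp
    · obtain ⟨k, -, h⟩ := mem_image.1 hp
      have := congrArg Prod.fst h
      simp only [rowSquare, hfst] at this
      omega
    · obtain ⟨k, -, h⟩ := mem_image.1 hp
      have h1 := congrArg Prod.fst h
      have h2 := congrArg Prod.snd h
      simp only [hfst] at h1
      obtain rfl : k = l := by omega
      simp only [hsnd] at h2
      cases hb : b k <;> rw [hb] at h2 <;> simp at h2

open MvPolynomial in
theorem matchingSum_graphA (N : ℕ) : (graphA N).toWeightedGraph.matchingSum =
    (1 + X 1) * growth (X 0) (X 1) (N + 1) - X 1 * X 0 ^ 4 * growth (X 0) (X 1) N := by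
  have hD := isValid_layoutA N
  rw [graphA_eq, matchingSum_toCellGraph hD isOdd_sub_one (a := -N) (n := N + 2)]
  · refine hafnian_south_row N ?_ rfl (fun k h1 h2 => ⟨?_, rfl⟩) ?_ rfl
    · apply corners_eastern hD <;> simp [layoutA]
    · apply corners_south <;> simp [layoutA] <;> omega
    · apply corners_western hD <;> simp [layoutA]
  · intro k hk
    have := mem_of_corners_nonempty hD hk
    simp only [layoutA, mem_Icc] at this
    omega

open MvPolynomial in
theorem matchingSum_graphD (N : ℕ) : (graphD N).toWeightedGraph.matchingSum =
    growth (X 0) (X 1) (N + 1) - X 1 * (1 + X 1) * growth (X 0) (X 1) N := by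
  have hD := isValid_layoutD N
  rw [graphD_eq, matchingSum_toCellGraph hD isOdd_sub_one (a := 1 - N) (n := N)]
  · refine hafnian_north_row N fun k h1 h2 => ⟨?_, rfl⟩
    apply corners_north <;> simp [layoutD] <;> omega
  · intro k hk
    have := mem_of_corners_nonempty hD hk
    simp only [layoutD, mem_Icc] at this
    omega

open MvPolynomial in
theorem matchingSum_graphB (N : ℕ) : (graphB N).toWeightedGraph.matchingSum =
    X 0 ^ 4 * growth (X 0) (X 1) (N + 1) ^ 2 +
      (growth (X 0) (X 1) (N + 2) - X 0 ^ 4 * growth (X 0) (X 1) (N + 1)) ^ 2 := by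
  have hD := isValid_layoutB N
  rw [graphB_eq, matchingSum_toCellGraph hD isEven_sub_one (a := -N - 1) (n := 2 * N + 3)]
  · refine hafnian_south_north_row N ?_ (if_pos (by omega))
      (fun k h1 h2 => ⟨?_, if_pos (by omega)⟩) ?_ (if_pos (by omega))
      (fun k h1 h2 => ⟨?_, if_neg (by omega)⟩) ?_ (if_neg (by omega))
    · apply corners_eastern hD <;> simp [layoutB]
      omega
    · apply corners_south <;> simp [layoutB] <;> omega
    · apply corners_both <;> simp [layoutB] <;> omega
    · apply corners_north <;> simp [layoutB] <;> omega
    · apply corners_western hD <;> simp [layoutB] <;> omega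
  · intro k hk
    have := mem_of_corners_nonempty hD hk
    simp only [layoutB, mem_Icc] at this
    push_cast
    omega

open MvPolynomial in
theorem matchingSum_graphC (N : ℕ) : (graphC N).toWeightedGraph.matchingSum =
    X 0 ^ 4 * (growth (X 0) (X 1) (N + 1) - X 1 ^ 2 * growth (X 0) (X 1) N) ^ 2 +
      growth (X 0) (X 1) (N + 1) ^ 2 := by
  have hD := isValid_layoutC N
  rw [graphC_eq, matchingSum_toCellGraph hD isOdd_sub_one (a := -N) (n := 2 * N + 1)]
  · refine hafnian_north_south_row N (fun k h1 h2 => ⟨?_, if_pos (by omega)⟩) ?_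
      (if_pos (by omega)) (fun k h1 h2 => ⟨?_, if_neg (by omega)⟩)
    · apply corners_north <;> simp [layoutC] <;> omega
    · apply corners_bare <;> simp [layoutC]
    · apply corners_south <;> simp [layoutC] <;> omega
  · intro k hk
    have := mem_of_corners_nonempty hD hk
    simp only [layoutC, mem_Icc] at this
    push_cast
    omega

end Layout

theorem clusterGraph_odd_pos (N : ℕ) : clusterGraph (2 * N + 3) = graphA N := by
  have h : Odd (2 * N + 3 : ℤ) := ⟨N + 1, by ring⟩
  rw [clusterGraph, if_pos h, if_pos (by omega)]
  congr 1
  omega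

theorem clusterGraph_odd_neg (N : ℕ) : clusterGraph (1 - 2 * N) = graphD N := by
  have h : Odd (1 - 2 * N : ℤ) := ⟨-N, by ring⟩
  rw [clusterGraph, if_pos h, if_neg (by omega)]
  congr 1
  omega

theorem clusterGraph_even_pos (N : ℕ) : clusterGraph (2 * N + 4) = graphB N := by
  have h : ¬ Odd (2 * N + 4 : ℤ) := by rw [Int.not_odd_iff_even]; exact ⟨N + 2, by ring⟩
  rw [clusterGraph, if_neg h, if_pos (by omega)]
  congr 1
  omega

theorem clusterGraph_even_neg (N : ℕ) : clusterGraph (-2 * N) = graphC N := by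
  have h : ¬ Odd (-2 * N : ℤ) := by rw [Int.not_odd_iff_even]; exact ⟨-N, by ring⟩
  rw [clusterGraph, if_neg h, if_neg (by omega)]
  congr 1
  omega

theorem sqNum_odd_pos (N : ℕ) : sqNum (2 * N + 3) = 2 * N + 1 := by
  have h : Odd (2 * N + 3 : ℤ) := ⟨N + 1, by ring⟩
  rw [sqNum, if_pos h, abs_of_nonneg (by omega)]
  ring

theorem sqNum_odd_neg (N : ℕ) : sqNum (1 - 2 * N) = 2 * N - 1 := by
  have h : Odd (1 - 2 * N : ℤ) := ⟨-N, by ring⟩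
  rw [sqNum, if_pos h, abs_of_nonpos (by omega)]
  ring

theorem sqNum_even_pos (N : ℕ) : sqNum (2 * N + 4) = 4 * N + 4 := by
  have h : ¬ Odd (2 * N + 4 : ℤ) := by rw [Int.not_odd_iff_even]; exact ⟨N + 2, by ring⟩
  rw [sqNum, if_neg h, abs_of_nonneg (by omega)]
  ring

theorem sqNum_even_neg (N : ℕ) : sqNum (-2 * N) = 4 * N := by
  have h : ¬ Odd (-2 * N : ℤ) := by rw [Int.not_odd_iff_even]; exact ⟨-N, by ring⟩
  rw [sqNum, if_neg h, abs_of_nonpos (by omega)]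
  ring

theorem octNum_odd_pos (N : ℕ) : octNum (2 * N + 3) = N := by
  have h : Odd (2 * N + 3 : ℤ) := ⟨N + 1, by ring⟩
  rw [octNum, if_pos h, abs_of_nonneg (by omega)]
  omega

theorem octNum_odd_neg (N : ℕ) : octNum (1 - 2 * N) = N := by
  have h : Odd (1 - 2 * N : ℤ) := ⟨-N, by ring⟩
  rw [octNum, if_pos h, abs_of_nonpos (by omega)]
  omega

theorem octNum_even_pos (N : ℕ) : octNum (2 * N + 4) = 2 * N + 1 := by
  have h : ¬ Odd (2 * N + 4 : ℤ) := by rw [Int.not_odd_iff_even]; exact ⟨N + 2, by ring⟩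
  rw [octNum, if_neg h, abs_of_nonneg (by omega)]
  ring

theorem octNum_even_neg (N : ℕ) : octNum (-2 * N) = 2 * N + 1 := by
  have h : ¬ Odd (-2 * N : ℤ) := by rw [Int.not_odd_iff_even]; exact ⟨-N, by ring⟩
  rw [octNum, if_neg h, abs_of_nonpos (by omega)]
  ring

/-- The four families of indices. -/
theorem index_cases {P : ℤ → Prop} (hA : ∀ N : ℕ, P (2 * N + 3)) (hB : ∀ N : ℕ, P (2 * N + 4))
    (hC : ∀ N : ℕ, P (-2 * N)) (hD : ∀ N : ℕ, N ≠ 0 → P (1 - 2 * N)) (n : ℤ) (h1 : n ≠ 1)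
    (h2 : n ≠ 2) : P n := by
  rcases Int.even_or_odd' n with ⟨m, rfl | rfl⟩
  · rcases (show 2 ≤ m ∨ m ≤ 0 by omega) with h | h
    · convert hB (m - 2).toNat using 1
      omega
    · convert hC (-m).toNat using 1
      omega
  · rcases (show 1 ≤ m ∨ m < 0 by omega) with h | h
    · convert hA (m - 1).toNat using 1
      omega
    · convert hD (-m).toNat (by omega) using 1
      omega

theorem card_squares_and_octagons (n : ℤ) (h1 : n ≠ 1) (h2 : n ≠ 2) :
    ((clusterGraph n).squares.card : ℤ) = sqNum n ∧
      ((clusterGraph n).octagons.card : ℤ) = octNum n := by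
  refine index_cases (P := fun n => ((clusterGraph n).squares.card : ℤ) = sqNum n ∧
      ((clusterGraph n).octagons.card : ℤ) = octNum n) ?_ ?_ ?_ ?_ n h1 h2
  · intro N
    rw [clusterGraph_odd_pos, sqNum_odd_pos, octNum_odd_pos, Layout.graphA_eq,
      Layout.card_squares_toCellGraph, Layout.card_octagons_toCellGraph]
    simp only [Layout.layoutA, Int.card_Icc, card_empty]
    omega
  · intro N
    rw [clusterGraph_even_pos, sqNum_even_pos, octNum_even_pos, Layout.graphB_eq,
      Layout.card_squares_toCellGraph, Layout.card_octagons_toCellGraph]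
    simp only [Layout.layoutB, Int.card_Icc]
    omega
  · intro N
    rw [clusterGraph_even_neg, sqNum_even_neg, octNum_even_neg, Layout.graphC_eq,
      Layout.card_squares_toCellGraph, Layout.card_octagons_toCellGraph]
    simp only [Layout.layoutC, Int.card_Icc]
    omega
  · intro N hN
    rw [clusterGraph_odd_neg, sqNum_odd_neg, octNum_odd_neg, Layout.graphD_eq,
      Layout.card_squares_toCellGraph, Layout.card_octagons_toCellGraph]
    simp only [Layout.layoutD, Int.card_Icc, card_empty]
    omega

/-! ### The recurrence for the matching polynomials -/

section Growth

variable {R : Type*} [CommRing R] (s y : R)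

theorem map_growth {S G : Type*} [CommRing S] [FunLike G R S] [RingHomClass G R S] (φ : G)
    (n : ℕ) :
    φ (growth s y n) = growth (φ s) (φ y) n := by
  induction n using growth.induct with
  | case1 => simp [growth]
  | case2 => simp [growth]
  | case3 n ih1 ih2 => simp [growth, ih1, ih2]

/-- The conserved quantity of the recurrence. -/
theorem growth_invariant (n : ℕ) :
    growth s y (n + 1) ^ 2 - (s ^ 4 + (1 + y) ^ 2) * growth s y n * growth s y (n + 1) +
      s ^ 4 * y ^ 2 * growth s y n ^ 2 = (s ^ 4 * y ^ 2) ^ n := by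
  induction n with
  | zero => simp [growth]
  | succ n ih =>
    rw [pow_succ (s ^ 4 * y ^ 2), ← ih, growth]
    ring

theorem growth_zero_zero (n : ℕ) : growth (0 : R) 0 (n + 1) = 1 := by
  induction n with
  | zero => rfl
  | succ n ih => rw [growth, ih]; ring

/-- The matching polynomial of `graphA n`. -/
def numA (n : ℕ) : R := (1 + y) * growth s y (n + 1) - y * s ^ 4 * growth s y n

/-- The matching polynomial of `graphD n`. -/
def numD (n : ℕ) : R := growth s y (n + 1) - y * (1 + y) * growth s y n

/-- The matching polynomial of `graphB n`. -/
def numB (n : ℕ) : R := s ^ 4 * growth s y (n + 1) ^ 2 +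
  (growth s y (n + 2) - s ^ 4 * growth s y (n + 1)) ^ 2

/-- The matching polynomial of `graphC n`. -/
def numC (n : ℕ) : R := s ^ 4 * (growth s y (n + 1) - y ^ 2 * growth s y n) ^ 2 +
  growth s y (n + 1) ^ 2

/-- The relation `x_{2n+5} x_{2n+3} = x_{2n+4} + 1` without denominators. -/
theorem numA_succ_mul (n : ℕ) :
    numA s y (n + 1) * numA s y n = numB s y n + s ^ (4 * n + 4) * y ^ (2 * n + 1) := by
  have h := growth_invariant s y n
  have hK : s ^ (4 * n + 4) * y ^ (2 * n + 1) = s ^ 4 * y * (s ^ 4 * y ^ 2) ^ n := by ring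
  rw [hK, ← h]
  simp only [numA, numB, growth]
  ring

/-- The relation `x_{2n+6} x_{2n+4} = x_{2n+5} ^ 4 + 1` without denominators. -/
theorem numB_succ_mul (n : ℕ) :
    numB s y (n + 1) * numB s y n =
      numA s y (n + 1) ^ 4 + s ^ (8 * n + 12) * y ^ (4 * n + 4) := by
  have h := growth_invariant s y n
  have hK : s ^ (8 * n + 12) * y ^ (4 * n + 4) =
      s ^ 12 * y ^ 4 * ((s ^ 4 * y ^ 2) ^ n) ^ 2 := by ring
  rw [hK, ← h]
  simp only [numA, numB, growth]
  ring

/-- The relation `x_{1-2n} x_{-1-2n} = x_{-2n} + 1` without denominators. -/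
theorem numD_succ_mul (n : ℕ) :
    numD s y (n + 1) * numD s y n = numC s y n + s ^ (4 * n) * y ^ (2 * n + 1) := by
  have h := growth_invariant s y n
  have hK : s ^ (4 * n) * y ^ (2 * n + 1) = y * (s ^ 4 * y ^ 2) ^ n := by ring
  rw [hK, ← h]
  simp only [numD, numC, growth]
  ring

/-- The relation `x_{-2n} x_{-2n-2} = x_{-2n-1} ^ 4 + 1` without denominators. -/
theorem numC_succ_mul (n : ℕ) :
    numC s y (n + 1) * numC s y n =
      numD s y (n + 1) ^ 4 + s ^ (8 * n + 4) * y ^ (4 * n + 4) := by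
  have h := growth_invariant s y n
  have hK : s ^ (8 * n + 4) * y ^ (4 * n + 4) =
      s ^ 4 * y ^ 4 * ((s ^ 4 * y ^ 2) ^ n) ^ 2 := by ring
  rw [hK, ← h]
  simp only [numC, numD, growth]
  ring

end Growth

section MatchingPoly

open MvPolynomial

theorem matchingPoly_odd_pos (N : ℕ) : matchingPoly (2 * N + 3) = numA (X 0) (X 1) N := by
  rw [matchingPoly, clusterGraph_odd_pos, Layout.matchingSum_graphA, numA]

theorem matchingPoly_odd_neg (N : ℕ) : matchingPoly (1 - 2 * N) = numD (X 0) (X 1) N := by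
  rw [matchingPoly, clusterGraph_odd_neg, Layout.matchingSum_graphD, numD]

theorem matchingPoly_even_pos (N : ℕ) : matchingPoly (2 * N + 4) = numB (X 0) (X 1) N := by
  rw [matchingPoly, clusterGraph_even_pos, Layout.matchingSum_graphB, numB]

theorem matchingPoly_even_neg (N : ℕ) : matchingPoly (-2 * N) = numC (X 0) (X 1) N := by
  rw [matchingPoly, clusterGraph_even_neg, Layout.matchingSum_graphC, numC]

/-- The weights of a matching multiply to a monomial. -/
theorem prod_weight_eq (C : CellGraph) (S : Finset (Sym2 Pt)) :
    ∃ i j : ℕ, ∏ e ∈ S, C.toWeightedGraph.weight e = X 0 ^ i * X 1 ^ j := by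
  induction S using Finset.induction_on with
  | empty => exact ⟨0, 0, by simp⟩
  | insert e S he ih =>
    obtain ⟨i, j, h⟩ := ih
    rw [prod_insert he, h]
    simp only [CellGraph.toWeightedGraph]
    split_ifs
    · exact ⟨i + 1, j, by ring⟩
    · exact ⟨i, j + 1, by ring⟩
    · exact ⟨i, j, by ring⟩

theorem coeff_matchingSum_nonneg (C : CellGraph) (d : Fin 2 →₀ ℕ) :
    0 ≤ (C.toWeightedGraph.matchingSum).coeff d := by
  rw [WeightedGraph.matchingSum, coeff_sum]
  refine sum_nonneg fun S _ => ?_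
  obtain ⟨i, j, h⟩ := prod_weight_eq C S
  rw [h, X_pow_eq_monomial, X_pow_eq_monomial, monomial_mul, coeff_monomial]
  split_ifs <;> simp

/-- The constant coefficient of every matching polynomial is `1`. -/
theorem matchingPoly_ne_zero (n : ℤ) (h1 : n ≠ 1) (h2 : n ≠ 2) : matchingPoly n ≠ 0 := by
  have key : ∀ p : MvPolynomial (Fin 2) ℤ, constantCoeff p = 1 → p ≠ 0 := by
    rintro _ h rfl
    simp at h
  refine index_cases (P := fun n => matchingPoly n ≠ 0) ?_ ?_ ?_ ?_ n h1 h2 <;> intro N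
  · rw [matchingPoly_odd_pos]
    exact key _ (by simp [numA, map_growth, growth_zero_zero])
  · rw [matchingPoly_even_pos]
    exact key _ (by simp [numB, map_growth, growth_zero_zero])
  · rw [matchingPoly_even_neg]
    exact key _ (by simp [numC, map_growth, growth_zero_zero])
  · rintro -
    rw [matchingPoly_odd_neg]
    exact key _ (by simp [numD, map_growth, growth_zero_zero])

end MatchingPoly

section Sequence

variable {F : Type*} [Field F]

/-- Running backwards is running forwards with the roles of the two terms and the two exponents
exchanged. -/
theorem backwardPair_eq (b c : ℕ) (u v : F) (m : ℕ) :
    backwardPair b c u v m = (forwardPair c b v u m).swap := by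
  induction m with
  | zero => rfl
  | succ m ih =>
    have hodd : Odd (m + 3) ↔ ¬ Odd m := by simp [Nat.odd_add, Nat.even_add_one, parity_simps]
    simp only [backwardPair, forwardPair, ih, Prod.swap, hodd]
    split_ifs <;> rfl

/-- Reversing the sequence exchanges the two exponents and the two initial terms. -/
theorem clusterSeq_neg (b c : ℕ) (u v : F) (n : ℤ) :
    clusterSeq b c u v (-n) = clusterSeq c b v u (n + 3) := by
  have hback : ∀ (b c : ℕ) (u v : F) (m : ℕ),
      (backwardPair b c u v m).1 = (forwardPair c b v u (m + 1)).1 := by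
    intro b c u v m
    rw [backwardPair_eq]
    rfl
  have hforw : ∀ (b c : ℕ) (u v : F) (m : ℕ),
      (forwardPair b c u v (m + 1)).1 = (backwardPair c b v u m).1 := fun b c u v m =>
    (hback c b v u m).symm
  unfold clusterSeq
  split_ifs with h1 h2 h2
  · obtain rfl | rfl : n = -1 ∨ n = -2 := by omega
    · rfl
    · rfl
  · obtain ⟨m, hm⟩ := Int.eq_ofNat_of_zero_le (show 0 ≤ -n - 2 by omega)
    rw [show (-n - 1).toNat = m + 1 by omega, show (1 - (n + 3)).toNat = m by omega, hforw]
  · obtain ⟨m, hm⟩ := Int.eq_ofNat_of_zero_le (show 0 ≤ 1 + n by omega)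
    rw [show (n + 3 - 1).toNat = m + 1 by omega, show (1 - -n).toNat = m by omega, hback]
  · omega

/-- A sequence of non-zero terms that obeys the recurrence is the sequence determined by its first
two terms. -/
theorem clusterSeq_eq_of_recurrence (b c : ℕ) (x : ℤ → F) (h0 : ∀ n, x n ≠ 0)
    (h : ∀ n, x n * x (n - 2) = x (n - 1) ^ (if Odd n then b else c) + 1) (n : ℤ) :
    clusterSeq b c (x 1) (x 2) n = x n := by
  have hforw : ∀ m : ℕ, forwardPair b c (x 1) (x 2) m = (x (m + 1), x (m + 2)) := by
    intro m
    induction m with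
    | zero => rfl
    | succ m ih =>
      have hm := h (m + 3)
      rw [show (m + 3 - 2 : ℤ) = m + 1 by ring, show (m + 3 - 1 : ℤ) = m + 2 by ring] at hm
      have hodd : Odd (m + 3 : ℤ) ↔ Odd (m + 3) := by
        rw [← Int.odd_coe_nat]
        push_cast
        rfl
      simp only [forwardPair, ih]
      refine Prod.ext ?_ ?_
      · dsimp only
        congr 1
      · dsimp only
        rw [div_eq_iff (h0 _), show ((m + 1 : ℕ) : ℤ) + 2 = m + 3 by push_cast; ring, hm]
        simp only [hodd]
  have hback : ∀ m : ℕ, backwardPair b c (x 1) (x 2) m = (x (1 - m), x (2 - m)) := by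
    intro m
    induction m with
    | zero => simp [backwardPair]
    | succ m ih =>
      have hm := h (2 - m)
      rw [show (2 - m - 2 : ℤ) = -m by ring, show (2 - m - 1 : ℤ) = 1 - m by ring] at hm
      have hodd : Odd (2 - m : ℤ) ↔ Odd m := by
        rw [Int.odd_sub', ← Int.odd_coe_nat]
        simp
      simp only [backwardPair, ih]
      refine Prod.ext ?_ ?_
      · dsimp only
        rw [div_eq_iff (h0 _), show 1 - ((m + 1 : ℕ) : ℤ) = -m by push_cast; ring, mul_comm, hm]
        simp only [hodd]
      · dsimp only
        congr 1
        push_cast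
        ring
  unfold clusterSeq
  split_ifs with hn
  · rw [hforw]
    dsimp only
    congr 1
    omega
  · rw [hback]
    dsimp only
    congr 1
    omega

end Sequence

/-! ### The combinatorial formula and positivity -/

section Formula

variable {F : Type*} [Field F] [Algebra ℤ F] (u v : F)

/-- The quotients of the combinatorial formula, at arbitrary initial terms `u` and `v`, which are
put in at `n = 1` and `n = 2`, where there is no graph. -/
noncomputable def matchingSeq (n : ℤ) : F :=
  if n = 1 then u else if n = 2 then v
  else MvPolynomial.aeval ![u, v] (matchingPoly n) / (u ^ sqNum n * v ^ octNum n)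

theorem matchingSeq_of_ne {n : ℤ} (h1 : n ≠ 1) (h2 : n ≠ 2) : matchingSeq u v n =
    MvPolynomial.aeval ![u, v] (matchingPoly n) / (u ^ sqNum n * v ^ octNum n) := by
  rw [matchingSeq, if_neg h1, if_neg h2]

theorem matchingSeq_odd_pos (N : ℕ) :
    matchingSeq u v (2 * N + 3) = numA u v N / (u ^ (2 * N + 1) * v ^ N) := by
  rw [matchingSeq_of_ne u v (by omega) (by omega), matchingPoly_odd_pos, sqNum_odd_pos,
    octNum_odd_pos]
  congr 1
  · simp [numA, map_growth]
  · norm_cast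

theorem matchingSeq_even_pos (N : ℕ) :
    matchingSeq u v (2 * N + 4) = numB u v N / (u ^ (4 * N + 4) * v ^ (2 * N + 1)) := by
  rw [matchingSeq_of_ne u v (by omega) (by omega), matchingPoly_even_pos, sqNum_even_pos,
    octNum_even_pos]
  congr 1
  · simp [numB, map_growth]
  · norm_cast

theorem matchingSeq_even_neg (N : ℕ) :
    matchingSeq u v (-2 * N) = numC u v N / (u ^ (4 * N) * v ^ (2 * N + 1)) := by
  rw [matchingSeq_of_ne u v (by omega) (by omega), matchingPoly_even_neg, sqNum_even_neg,
    octNum_even_neg]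
  congr 1
  · simp [numC, map_growth]
  · norm_cast

variable {u v}

/-- For `N = 0` this is the initial term `u`, as `numD u v 0 = 1`. -/
theorem matchingSeq_odd_neg (hu : u ≠ 0) (N : ℕ) :
    matchingSeq u v (1 - 2 * N) = u * numD u v N / (u ^ (2 * N) * v ^ N) := by
  rcases Nat.eq_zero_or_pos N with rfl | hN
  · simp [matchingSeq, numD, growth]
  · rw [matchingSeq_of_ne u v (by omega) (by omega), matchingPoly_odd_neg, sqNum_odd_neg,
      octNum_odd_neg, zpow_sub_one₀ hu, zpow_natCast]
    have h1 : MvPolynomial.aeval ![u, v]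
        (numD (MvPolynomial.X 0) (MvPolynomial.X 1) N : MvPolynomial (Fin 2) ℤ) =
        numD u v N := by
      simp [numD, map_growth]
    have h2 : u ^ (2 * N : ℤ) = u ^ (2 * N) := by norm_cast
    rw [h1, h2]
    field_simp

theorem matchingSeq_one : matchingSeq u v 1 = u := by simp [matchingSeq]

theorem matchingSeq_two : matchingSeq u v 2 = v := by simp [matchingSeq]

theorem matchingSeq_ne_zero (hu : u ≠ 0) (hv : v ≠ 0)
    (hp : ∀ p : MvPolynomial (Fin 2) ℤ, p ≠ 0 → MvPolynomial.aeval ![u, v] p ≠ 0) (n : ℤ) :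
    matchingSeq u v n ≠ 0 := by
  by_cases h1 : n = 1
  · rwa [h1, matchingSeq_one]
  by_cases h2 : n = 2
  · rwa [h2, matchingSeq_two]
  rw [matchingSeq_of_ne u v h1 h2]
  exact div_ne_zero (hp _ (matchingPoly_ne_zero n h1 h2))
    (mul_ne_zero (zpow_ne_zero _ hu) (zpow_ne_zero _ hv))

theorem matchingSeq_recurrence (hu : u ≠ 0) (hv : v ≠ 0) (n : ℤ) :
    matchingSeq u v n * matchingSeq u v (n - 2) =
      matchingSeq u v (n - 1) ^ (if Odd n then 1 else 4) + 1 := by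
  rcases Int.even_or_odd' n with ⟨m, rfl | rfl⟩
  · rw [if_neg (by simp)]
    rcases (show 3 ≤ m ∨ m = 2 ∨ m = 1 ∨ m ≤ 0 by omega) with h | rfl | rfl | h
    · obtain ⟨N, rfl⟩ : ∃ N : ℕ, m = N + 3 := ⟨(m - 3).toNat, by omega⟩
      rw [show 2 * (N + 3 : ℤ) = 2 * (N + 1 : ℕ) + 4 by push_cast; ring,
        show 2 * ((N + 1 : ℕ) : ℤ) + 4 - 2 = 2 * N + 4 by push_cast; ring,
        show 2 * ((N + 1 : ℕ) : ℤ) + 4 - 1 = 2 * (N + 1 : ℕ) + 3 by ring,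
        matchingSeq_even_pos, matchingSeq_even_pos, matchingSeq_odd_pos, div_mul_div_comm,
        numB_succ_mul]
      field_simp
      ring
    · have h4 := matchingSeq_even_pos u v 0
      have h3 := matchingSeq_odd_pos u v 0
      simp only [Nat.cast_zero, mul_zero, zero_add] at h3 h4
      norm_num
      rw [h3, h4, matchingSeq_two]
      simp only [numA, numB, growth]
      field_simp
      ring
    · have h0 := matchingSeq_even_neg u v 0
      simp only [Nat.cast_zero, mul_zero, zero_add] at h0
      norm_num
      rw [h0, matchingSeq_one, matchingSeq_two]
      simp only [numC, growth]
      field_simp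
      ring
    · obtain ⟨N, rfl⟩ : ∃ N : ℕ, m = -N := ⟨(-m).toNat, by omega⟩
      rw [show 2 * (-N : ℤ) = -2 * N by ring,
        show -2 * (N : ℤ) - 2 = -2 * (N + 1 : ℕ) by push_cast; ring,
        show -2 * (N : ℤ) - 1 = 1 - 2 * (N + 1 : ℕ) by push_cast; ring,
        matchingSeq_even_neg, matchingSeq_even_neg, matchingSeq_odd_neg hu, div_mul_div_comm,
        mul_comm (numC u v N), numC_succ_mul]
      field_simp
      ring
  · rw [if_pos (by simp), pow_one]
    rcases (show 2 ≤ m ∨ m = 1 ∨ m ≤ 0 by omega) with h | rfl | h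
    · obtain ⟨N, rfl⟩ : ∃ N : ℕ, m = N + 2 := ⟨(m - 2).toNat, by omega⟩
      rw [show 2 * (N + 2 : ℤ) + 1 = 2 * (N + 1 : ℕ) + 3 by push_cast; ring,
        show 2 * ((N + 1 : ℕ) : ℤ) + 3 - 2 = 2 * N + 3 by push_cast; ring,
        show 2 * ((N + 1 : ℕ) : ℤ) + 3 - 1 = 2 * N + 4 by push_cast; ring,
        matchingSeq_odd_pos, matchingSeq_odd_pos, matchingSeq_even_pos, div_mul_div_comm,
        numA_succ_mul]
      field_simp
      ring
    · have h3 := matchingSeq_odd_pos u v 0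
      simp only [Nat.cast_zero, mul_zero, zero_add] at h3
      norm_num
      rw [h3, matchingSeq_one, matchingSeq_two]
      simp only [numA, growth]
      field_simp
      ring
    · obtain ⟨N, rfl⟩ : ∃ N : ℕ, m = -N := ⟨(-m).toNat, by omega⟩
      rw [show 2 * (-N : ℤ) + 1 = 1 - 2 * N by ring,
        show 1 - 2 * (N : ℤ) - 2 = 1 - 2 * (N + 1 : ℕ) by push_cast; ring,
        show 1 - 2 * (N : ℤ) - 1 = -2 * N by ring,
        matchingSeq_even_neg, matchingSeq_odd_neg hu, matchingSeq_odd_neg hu, div_mul_div_comm,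
        show u * numD u v N * (u * numD u v (N + 1)) =
          u ^ 2 * (numD u v (N + 1) * numD u v N) by ring, numD_succ_mul]
      field_simp
      ring

theorem clusterSeq_one_four (hu : u ≠ 0) (hv : v ≠ 0)
    (hp : ∀ p : MvPolynomial (Fin 2) ℤ, p ≠ 0 → MvPolynomial.aeval ![u, v] p ≠ 0) (n : ℤ) :
    clusterSeq 1 4 u v n = matchingSeq u v n := by
  have := clusterSeq_eq_of_recurrence 1 4 (matchingSeq u v) (matchingSeq_ne_zero hu hv hp)
    (matchingSeq_recurrence hu hv) n
  rwa [matchingSeq_one, matchingSeq_two] at this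

end Formula

section Positivity

theorem IsPositiveLaurent.zero : IsPositiveLaurent 0 := ⟨0, by simp⟩

theorem IsPositiveLaurent.add {f g : RatFun} (hf : IsPositiveLaurent f)
    (hg : IsPositiveLaurent g) : IsPositiveLaurent (f + g) := by
  obtain ⟨a, rfl⟩ := hf
  obtain ⟨b, rfl⟩ := hg
  refine ⟨a + b, ?_⟩
  rw [Finsupp.sum_add_index']
  · intro e
    simp
  · intro e m m'
    push_cast
    ring

theorem IsPositiveLaurent.sum {ι : Type*} (S : Finset ι) (f : ι → RatFun)
    (h : ∀ i ∈ S, IsPositiveLaurent (f i)) : IsPositiveLaurent (∑ i ∈ S, f i) :=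
  Finset.sum_induction f IsPositiveLaurent (fun _ _ => IsPositiveLaurent.add) .zero h

theorem isPositiveLaurent_monomial (i j : ℤ) : IsPositiveLaurent (x₁ ^ i * x₂ ^ j) :=
  ⟨Finsupp.single (i, j) 1, by simp⟩

variable {u v : RatFun}

theorem isPositiveLaurent_matchingSeq (hu : u ≠ 0) (hv : v ≠ 0)
    (h : ∀ i j : ℤ, IsPositiveLaurent (u ^ i * v ^ j)) (n : ℤ) :
    IsPositiveLaurent (matchingSeq u v n) := by
  by_cases h1 : n = 1
  · rw [h1, matchingSeq_one]
    simpa using h 1 0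
  by_cases h2 : n = 2
  · rw [h2, matchingSeq_two]
    simpa using h 0 1
  rw [matchingSeq_of_ne u v h1 h2, matchingPoly, WeightedGraph.matchingSum, map_sum, sum_div]
  refine IsPositiveLaurent.sum _ _ fun S _ => ?_
  obtain ⟨i, j, hij⟩ := prod_weight_eq (clusterGraph n) S
  convert h (i - sqNum n) (j - octNum n) using 1
  rw [hij, zpow_sub₀ hu, zpow_sub₀ hv, div_mul_div_comm]
  simp

end Positivity

section Generators

theorem x₁_ne_zero : x₁ ≠ 0 := by
  rw [x₁, Ne, IsFractionRing.to_map_eq_zero_iff]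
  exact MvPolynomial.X_ne_zero 0

theorem x₂_ne_zero : x₂ ≠ 0 := by
  rw [x₂, Ne, IsFractionRing.to_map_eq_zero_iff]
  exact MvPolynomial.X_ne_zero 1

/-- The variables are algebraically independent. -/
theorem aeval_x₁_x₂_ne_zero (p : MvPolynomial (Fin 2) ℤ) (hp : p ≠ 0) :
    MvPolynomial.aeval ![x₁, x₂] p ≠ 0 := by
  have h : (MvPolynomial.aeval ![x₁, x₂] : MvPolynomial (Fin 2) ℤ →ₐ[ℤ] RatFun) =
      (Algebra.ofId (MvPolynomial (Fin 2) ℤ) RatFun).restrictScalars ℤ := by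
    ext i
    fin_cases i <;> simp [x₁, x₂, Algebra.ofId_apply]
  rw [h]
  simpa [Algebra.ofId_apply] using hp

theorem aeval_x₂_x₁_ne_zero (p : MvPolynomial (Fin 2) ℤ) (hp : p ≠ 0) :
    MvPolynomial.aeval ![x₂, x₁] p ≠ 0 := by
  have h : ![x₂, x₁] = ![x₁, x₂] ∘ Equiv.swap (0 : Fin 2) 1 := by
    ext i
    fin_cases i <;> simp
  rw [h, ← MvPolynomial.aeval_rename]
  refine aeval_x₁_x₂_ne_zero _ fun h0 => hp ?_
  exact MvPolynomial.rename_injective _ (Equiv.injective _) (by rw [h0, map_zero])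

end Generators

theorem clusterSeq_four_one (u v : RatFun) (n : ℤ) :
    clusterSeq 4 1 u v n = clusterSeq 1 4 v u (3 - n) := by
  rw [← neg_neg n, clusterSeq_neg, neg_neg, show -n + 3 = 3 - n by ring]

theorem theorem3p1 :
    -- the sequence is well defined and obeys the recurrence at all integers
    (clusterSeq 1 4 x₁ x₂ 1 = x₁ ∧ clusterSeq 1 4 x₁ x₂ 2 = x₂ ∧
      ∀ n : ℤ, clusterSeq 1 4 x₁ x₂ n ≠ 0 ∧
        clusterSeq 1 4 x₁ x₂ n =
          (clusterSeq 1 4 x₁ x₂ (n - 1) ^ (if Odd n then 1 else 4) + 1) /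
            clusterSeq 1 4 x₁ x₂ (n - 2)) ∧
    -- the combinatorial formula
    (∀ n : ℤ, n ≠ 1 → n ≠ 2 →
      clusterSeq 1 4 x₁ x₂ n =
        MvPolynomial.aeval ![x₁, x₂] (matchingPoly n) / (x₁ ^ sqNum n * x₂ ^ octNum n)) ∧
    -- the exponents count the squares and the octagons
    (∀ n : ℤ, n ≠ 1 → n ≠ 2 →
      ((clusterGraph n).squares.card : ℤ) = sqNum n ∧
      ((clusterGraph n).octagons.card : ℤ) = octNum n) ∧
    -- positivity
    (∀ n : ℤ, ∀ d : Fin 2 →₀ ℕ, 0 ≤ (matchingPoly n).coeff d) ∧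
    (∀ n : ℤ, IsPositiveLaurent (clusterSeq 1 4 x₁ x₂ n)) ∧
    -- reciprocity
    (∀ b c : ℕ, 0 < b → 0 < c → ∀ n : ℤ,
      clusterSeq b c x₁ x₂ (-n) = clusterSeq c b x₂ x₁ (n + 3)) ∧
    -- the (4,1) case
    (clusterSeq 4 1 x₁ x₂ 1 = x₁ ∧ clusterSeq 4 1 x₁ x₂ 2 = x₂ ∧
      ∀ n : ℤ, clusterSeq 4 1 x₁ x₂ n ≠ 0 ∧
        clusterSeq 4 1 x₁ x₂ n =
          (clusterSeq 4 1 x₁ x₂ (n - 1) ^ (if Odd n then 4 else 1) + 1) /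
            clusterSeq 4 1 x₁ x₂ (n - 2)) ∧
    (∀ n : ℤ, n ≠ 1 → n ≠ 2 →
      clusterSeq 4 1 x₁ x₂ n =
        MvPolynomial.aeval ![x₂, x₁] (matchingPoly (3 - n)) /
          (x₂ ^ sqNum (3 - n) * x₁ ^ octNum (3 - n))) ∧
    (∀ n : ℤ, IsPositiveLaurent (clusterSeq 4 1 x₁ x₂ n)) := by
  have hX := clusterSeq_one_four x₁_ne_zero x₂_ne_zero aeval_x₁_x₂_ne_zero
  have hX0 := matchingSeq_ne_zero x₁_ne_zero x₂_ne_zero aeval_x₁_x₂_ne_zero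
  have hXrec := matchingSeq_recurrence x₁_ne_zero x₂_ne_zero
  have hY : ∀ n, clusterSeq 4 1 x₁ x₂ n = matchingSeq x₂ x₁ (3 - n) := fun n => by
    rw [clusterSeq_four_one, clusterSeq_one_four x₂_ne_zero x₁_ne_zero aeval_x₂_x₁_ne_zero]
  have hY0 := matchingSeq_ne_zero x₂_ne_zero x₁_ne_zero aeval_x₂_x₁_ne_zero
  have hYrec := matchingSeq_recurrence x₂_ne_zero x₁_ne_zero
  refine ⟨⟨rfl, rfl, fun n => ⟨?_, ?_⟩⟩, fun n h1 h2 => ?_, card_squares_and_octagons,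
    fun n => coeff_matchingSum_nonneg _, fun n => ?_, fun b c _ _ => clusterSeq_neg b c x₁ x₂,
    ⟨rfl, rfl, fun n => ⟨?_, ?_⟩⟩, fun n h1 h2 => ?_, fun n => ?_⟩
  · rw [hX]
    exact hX0 n
  · rw [hX, hX, hX, eq_div_iff (hX0 _), hXrec]
  · rw [hX, matchingSeq_of_ne _ _ h1 h2]
  · rw [hX]
    exact isPositiveLaurent_matchingSeq x₁_ne_zero x₂_ne_zero isPositiveLaurent_monomial n
  · rw [hY]
    exact hY0 _
  · have h := hYrec (3 - (n - 2))
    have hodd : Odd (3 - (n - 2)) ↔ ¬ Odd n := by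
      simp [Int.odd_sub, show Odd (3 : ℤ) by decide, parity_simps]
    rw [show 3 - (n - 2) - 2 = 3 - n by ring, show 3 - (n - 2) - 1 = 3 - (n - 1) by ring] at h
    rw [hY, hY, hY, eq_div_iff (hY0 _), mul_comm, h]
    simp only [hodd, ite_not]
  · rw [hY, matchingSeq_of_ne _ _ (by omega) (by omega)]
  · rw [hY]
    refine isPositiveLaurent_matchingSeq x₂_ne_zero x₁_ne_zero (fun i j => ?_) _
    rw [mul_comm]
    exact isPositiveLaurent_monomial j i
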